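/- Let $H^{1/2}(-1,1)$ be the space of real functions $u\in L^2(-1,1)$ such that $\int_{-1}^1\int_{-1}^1\bigl(\frac{u(x)-u(y)}{x-y}\bigr)^2\,dx\,dy<\infty$, with the norm $\|u\|^2=\|u\|_{L^2}^2+\int_{-1}^1\int_{-1}^1\bigl(\frac{u(x)-u(y)}{x-y}\bigr)^2\,dx\,dy$, and let $H^{-1/2}(-1,1)$ be its dual space. Put $H_0^*=\{t\in H^{-1/2}(-1,1) : \langle t,1\rangle=0\}$ and $H_0=H^{1/2}(-1,1)/\mathbb{R}$ (functions modulo additive constants), and write $\mathring u\in H_0$ for the class of $u\in H^{1/2}(-1,1)$. Let $\mathrm{pv}\,\frac1x$ be the distributional derivative of $\log|x|$ on $\mathbb{R}$. Let $f\in\mathbb{R}$ be a constant. There is a continuous linear isomorphism $A:H_0^*\to H_0$ with continuous inverse such that, for all $t\in H_0^*$ and $u\in H^{1/2}(-1,1)$, one has $At=\mathring u$ if and only if $$-\frac1\pi\,\mathrm{pv}\frac1x * t+f\,t=u'\qquad\text{in the sense of distributions on } ]-1,1[,$$ where in the convolution $t$ is extended by zero to $\mathbb{R}$. Moreover, for every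 $u\in H^{1/2}(-1,1)$, the function $u^+(x):=\max\{u(x),0\}$ belongs to $H^{1/2}(-1,1)$ and $$\bigl\langle A^{-1}\mathring u,\,u^+\bigr\rangle\ \ge\ 0,$$ with equality if and only if $u^+$ is constant almost everywhere on $]-1,1[$. -/

import Mathlib

open MeasureTheory Set

noncomputable section

namespace Contact

/-- Lebesgue measure on the open interval `]-1,1[`. -/
abbrev μI : Measure ℝ := volume.restrict (Ioo (-1 : ℝ) 1)

/-- The difference quotient `(x, y) ↦ (u x - u y) / (x - y)`. Its value on the (negligible)
diagonal is irrelevant. -/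
def diffQuot (u : ℝ → ℝ) : ℝ × ℝ → ℝ := fun p => (u p.1 - u p.2) / (p.1 - p.2)

/-- `u ∈ H^{1/2}(-1,1)`: `u` and its difference quotient are square integrable on `]-1,1[`,
respectively on its square. -/
def MemH12 (u : ℝ → ℝ) : Prop :=
  MemLp u 2 μI ∧ MemLp (diffQuot u) 2 (μI.prod μI)

theorem diffQuot_congr {u v : ℝ → ℝ} (h : u =ᵐ[μI] v) :
    diffQuot u =ᵐ[μI.prod μI] diffQuot v := by
  have h1 := Measure.quasiMeasurePreserving_fst (μ := μI) (ν := μI) |>.ae_eq_comp h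
  have h2 := Measure.quasiMeasurePreserving_snd (μ := μI) (ν := μI) |>.ae_eq_comp h
  filter_upwards [h1, h2] with p hp1 hp2
  simp only [Function.comp_apply] at hp1 hp2
  simp [diffQuot, hp1, hp2]

theorem MemH12.congr {u v : ℝ → ℝ} (hu : MemH12 u) (h : u =ᵐ[μI] v) : MemH12 v :=
  ⟨hu.1.ae_eq h, hu.2.ae_eq (diffQuot_congr h)⟩

theorem diffQuot_add (u v : ℝ → ℝ) : diffQuot (u + v) = diffQuot u + diffQuot v := by
  funext p; simp only [diffQuot, Pi.add_apply]; ring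

theorem diffQuot_smul (c : ℝ) (u : ℝ → ℝ) : diffQuot (c • u) = c • diffQuot u := by
  funext p; simp only [diffQuot, Pi.smul_apply, smul_eq_mul]; ring

theorem MemH12.add {u v : ℝ → ℝ} (hu : MemH12 u) (hv : MemH12 v) : MemH12 (u + v) :=
  ⟨hu.1.add hv.1, by rw [diffQuot_add]; exact hu.2.add hv.2⟩

theorem MemH12.const_smul {u : ℝ → ℝ} (hu : MemH12 u) (c : ℝ) : MemH12 (c • u) :=
  ⟨hu.1.const_smul c, by rw [diffQuot_smul]; exact hu.2.const_smul c⟩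

theorem memH12_zero : MemH12 0 := by
  have h : diffQuot 0 = 0 := by funext p; simp [diffQuot]
  exact ⟨MemLp.zero, by rw [h]; exact MemLp.zero⟩

/-- `H^{1/2}(-1,1)` as a linear subspace of `L²(-1,1)`. -/
def H12sub : Submodule ℝ (Lp ℝ 2 μI) where
  carrier := {u | MemH12 u}
  zero_mem' := memH12_zero.congr (Lp.coeFn_zero ℝ 2 μI).symm
  add_mem' {u v} hu hv := (MemH12.add hu hv).congr (Lp.coeFn_add u v).symm
  smul_mem' c u hu := (MemH12.const_smul hu c).congr (Lp.coeFn_smul c u).symm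

/-- The space `H^{1/2}(-1,1)`, to be given its own norm below. -/
def H12 : Type := H12sub

instance : AddCommGroup H12 := inferInstanceAs (AddCommGroup H12sub)
instance : Module ℝ H12 := inferInstanceAs (Module ℝ H12sub)

namespace H12

/-- The embedding of `H^{1/2}(-1,1)` into `L²(-1,1)`. -/
def toL2 : H12 →ₗ[ℝ] Lp ℝ 2 μI := H12sub.subtype

/-- An element of `H^{1/2}(-1,1)` used as a function, defined almost everywhere on `]-1,1[`. -/
instance : CoeFun H12 (fun _ => ℝ → ℝ) := ⟨fun u => toL2 u⟩

theorem memH12 (u : H12) : MemH12 u := u.2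

/-- The class in `H^{1/2}(-1,1)` of a function. -/
def mk (u : ℝ → ℝ) (hu : MemH12 u) : H12 :=
  ⟨hu.1.toLp u, hu.congr hu.1.coeFn_toLp.symm⟩

theorem coeFn_mk (u : ℝ → ℝ) (hu : MemH12 u) : (mk u hu : ℝ → ℝ) =ᵐ[μI] u :=
  hu.1.coeFn_toLp

/-- The difference quotient as a linear map into `L²(]-1,1[²)`. -/
def quot : H12 →ₗ[ℝ] Lp ℝ 2 (μI.prod μI) where
  toFun u := u.memH12.2.toLp (diffQuot u)
  map_add' u v := by
    rw [← MemLp.toLp_add]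
    refine (MemLp.toLp_eq_toLp_iff _ _).2 ?_
    rw [← diffQuot_add]
    refine diffQuot_congr ?_
    rw [map_add]
    exact Lp.coeFn_add _ _
  map_smul' c u := by
    rw [RingHom.id_apply, ← MemLp.toLp_const_smul]
    refine (MemLp.toLp_eq_toLp_iff _ _).2 ?_
    rw [← diffQuot_smul]
    refine diffQuot_congr ?_
    rw [map_smul]
    exact Lp.coeFn_smul _ _

/-- The map `u ↦ (u, (u x - u y) / (x - y))` into the Hilbert sum `L²(-1,1) ⊕ L²(]-1,1[²)`. -/
def graph : H12 →ₗ[ℝ] WithLp 2 (Lp ℝ 2 μI × Lp ℝ 2 (μI.prod μI)) :=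
  (WithLp.linearEquiv 2 ℝ (Lp ℝ 2 μI × Lp ℝ 2 (μI.prod μI))).symm.toLinearMap ∘ₗ
    (toL2.prod quot)

theorem graph_injective : Function.Injective graph := by
  intro u v h
  have h' : (toL2.prod quot) u = (toL2.prod quot) v :=
    (WithLp.linearEquiv 2 ℝ (Lp ℝ 2 μI × Lp ℝ 2 (μI.prod μI))).symm.injective h
  exact Subtype.ext (congrArg Prod.fst h')

/-- The norm of `H^{1/2}(-1,1)`:
`‖u‖² = ‖u‖²_{L²} + ∫∫ ((u x - u y) / (x - y))² dx dy`. -/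
instance : NormedAddCommGroup H12 := NormedAddCommGroup.induced H12 _ graph graph_injective
instance : NormedSpace ℝ H12 := NormedSpace.induced ℝ H12 _ graph

theorem norm_sq_eq (u : H12) :
    ‖u‖ ^ 2 = (∫ x in Ioo (-1 : ℝ) 1, u x ^ 2)
      + ∫ p, ((u p.1 - u p.2) / (p.1 - p.2)) ^ 2 ∂(μI.prod μI) := by
  have hsq : ∀ {α : Type} [MeasurableSpace α] (ν : Measure α) (w : Lp ℝ 2 ν),
      ‖w‖ ^ 2 = ∫ x, w x ^ 2 ∂ν := by
    intro α _ ν w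
    rw [← real_inner_self_eq_norm_sq w, L2.inner_def (𝕜 := ℝ)]
    simp [pow_two]
  have h : ‖u‖ = ‖WithLp.toLp 2 (toL2 u, quot u)‖ := rfl
  rw [h, WithLp.prod_norm_sq_eq_of_L2]
  change ‖toL2 u‖ ^ 2 + ‖quot u‖ ^ 2 = _
  rw [hsq, hsq]
  suffices hq : ∫ p, (quot u) p ^ 2 ∂(μI.prod μI)
      = ∫ p, ((u p.1 - u p.2) / (p.1 - p.2)) ^ 2 ∂(μI.prod μI) by rw [hq]
  refine integral_congr_ae ?_
  filter_upwards [u.memH12.2.coeFn_toLp] with p hp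
  change (u.memH12.2.toLp (diffQuot u) : ℝ × ℝ → ℝ) p ^ 2 = _
  rw [hp]
  rfl

end H12

/-- A `C¹` function on the line restricts to an element of `H^{1/2}(-1,1)`. -/
theorem memH12_of_contDiff {ψ : ℝ → ℝ} (hψ : ContDiff ℝ 1 ψ) : MemH12 ψ := by
  obtain ⟨K, hK⟩ : ∃ K : NNReal, LipschitzOnWith K ψ (Icc (-1 : ℝ) 1) := by
    obtain ⟨C, hC⟩ := isCompact_Icc.exists_bound_of_continuousOn
      ((hψ.continuous_deriv le_rfl).continuousOn (s := Icc (-1 : ℝ) 1))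
    refine ⟨C.toNNReal, (convex_Icc _ _).lipschitzOnWith_of_nnnorm_deriv_le (𝕜 := ℝ)
      (fun x _ => (hψ.differentiable one_ne_zero) x) fun x hx => ?_⟩
    exact NNReal.le_toNNReal_of_coe_le (hC x hx)
  have hI : ∀ᵐ x ∂μI, x ∈ Ioo (-1 : ℝ) 1 := ae_restrict_mem measurableSet_Ioo
  have h1 : ∀ᵐ p ∂(μI.prod μI), p.1 ∈ Ioo (-1 : ℝ) 1 :=
    (Measure.quasiMeasurePreserving_fst (μ := μI) (ν := μI)).ae hI
  have h2 : ∀ᵐ p ∂(μI.prod μI), p.2 ∈ Ioo (-1 : ℝ) 1 :=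
    (Measure.quasiMeasurePreserving_snd (μ := μI) (ν := μI)).ae hI
  have hc := hψ.continuous
  constructor
  · obtain ⟨C, hC⟩ := isCompact_Icc.exists_bound_of_continuousOn
      (hc.continuousOn (s := Icc (-1 : ℝ) 1))
    refine MemLp.of_bound hc.aestronglyMeasurable C ?_
    filter_upwards [hI] with x hx
    exact hC x (Ioo_subset_Icc_self hx)
  · refine MemLp.of_bound ?_ (K : ℝ) ?_
    · have hm : Measurable (diffQuot ψ) :=
        ((hc.measurable.comp measurable_fst).sub (hc.measurable.comp measurable_snd)).div
          (measurable_fst.sub measurable_snd)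
      exact hm.aestronglyMeasurable
    · filter_upwards [h1, h2] with p hp1 hp2
      have h := hK.dist_le_mul _ (Ioo_subset_Icc_self hp1) _ (Ioo_subset_Icc_self hp2)
      rw [Real.dist_eq, Real.dist_eq] at h
      rw [diffQuot, Real.norm_eq_abs, abs_div]
      exact div_le_of_le_mul₀ (abs_nonneg _) K.2 h

/-- The restriction to `]-1,1[` of a `C¹` function on the line, in `H^{1/2}(-1,1)`. -/
def restr (ψ : ℝ → ℝ) (hψ : ContDiff ℝ 1 ψ) : H12 := H12.mk ψ (memH12_of_contDiff hψ)

/-- The constant function `1` in `H^{1/2}(-1,1)`. -/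
def one : H12 := restr (fun _ => 1) contDiff_const

/-- The dual space `H^{-1/2}(-1,1)`. -/
abbrev Hm12 : Type := StrongDual ℝ H12

/-- `H₀* = {t ∈ H^{-1/2}(-1,1) | ⟨t, 1⟩ = 0}`. -/
def H0star : Submodule ℝ Hm12 where
  carrier := {t | t one = 0}
  zero_mem' := rfl
  add_mem' {s t} hs ht := by
    change s one + t one = 0
    rw [show s one = 0 from hs, show t one = 0 from ht, add_zero]
  smul_mem' c t ht := by
    change c • t one = 0
    rw [show t one = 0 from ht, smul_zero]

/-- The quotient space `H₀ = H^{1/2}(-1,1) / ℝ`. -/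
abbrev H0 : Type := H12 ⧸ (Submodule.span ℝ {one})

/-- The class of `u` modulo additive constants. -/
abbrev toH0 (u : H12) : H0 := Submodule.Quotient.mk u

/-- The space `C_c^∞(]-1,1[)`. -/
abbrev TestI : Type := TestFunction (⟨Ioo (-1 : ℝ) 1, isOpen_Ioo⟩ : TopologicalSpace.Opens ℝ) ℝ ⊤

/-- The distribution `pv 1/x` on the line, that is, the distributional derivative of `log |x|`,
applied to a function `φ ∈ C_c^∞(ℝ)`. -/
def pvInv (φ : ℝ → ℝ) : ℝ := -∫ x, Real.log |x| * deriv φ x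

/-- `y ↦ ⟨pv 1/x, φ(x + y)⟩` is a smooth function on the line. -/
theorem contDiff_pvInv (φ : TestI) : ContDiff ℝ 1 (fun y => pvInv (fun x => φ (x + y))) := by
  have hlog : LocallyIntegrable (fun x : ℝ => Real.log |x|) volume := by
    simp only [Real.log_abs]
    refine (locallyIntegrable_iff).2 fun k hk => ?_
    obtain ⟨a, ha⟩ := hk.bddBelow
    obtain ⟨b, hb⟩ := hk.bddAbove
    have h := (intervalIntegral.intervalIntegrable_log' (a := a) (b := b)).1
    have h' : IntegrableOn Real.log (Icc a b) volume := by
      rwa [integrableOn_Icc_iff_integrableOn_Ioc]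
    exact h'.mono_set fun x hx => ⟨ha hx, hb hx⟩
  have hφ : ContDiff ℝ 1 (deriv φ) := by
    have h : ContDiff ℝ 2 φ := φ.contDiff.of_le (WithTop.coe_le_coe.2 (le_top : (2 : ℕ∞) ≤ ⊤))
    exact (contDiff_succ_iff_deriv.1 h).2.2
  have hs : HasCompactSupport (deriv φ) := φ.hasCompactSupport.deriv
  have h := hs.contDiff_convolution_right (n := 1) (ContinuousLinearMap.mul ℝ ℝ) hlog hφ
  have he : (fun y => pvInv (fun x => φ (x + y)))
      = -(convolution (fun x : ℝ => Real.log |x|) (deriv φ) (ContinuousLinearMap.mul ℝ ℝ)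
          volume) := by
    funext y
    rw [Pi.neg_apply, convolution_def, pvInv, ← integral_neg_eq_self]
    refine congrArg _ (integral_congr_ae (Filter.Eventually.of_forall fun x => ?_))
    simp only [ContinuousLinearMap.mul_apply', abs_neg, deriv_comp_add_const]
    rw [show -x + y = y - x by ring]
  rw [he]
  exact h.neg

/-- The convolution of `pv 1/x` with the extension by zero of `t ∈ H^{-1/2}(-1,1)`, applied to
`φ ∈ C_c^∞(]-1,1[)`: as usual `⟨S * T, φ⟩ = ⟨T_y, ⟨S_x, φ(x + y)⟩⟩`, and the extension by zero
of `t` acts on a function on the line through the restriction of the function to `]-1,1[`. -/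
def pvConv (t : Hm12) (φ : TestI) : ℝ :=
  t (restr (fun y => pvInv (fun x => φ (x + y))) (contDiff_pvInv φ))

/-- The distributional derivative of `u` on `]-1,1[`, applied to `φ ∈ C_c^∞(]-1,1[)`. -/
def distDeriv (u : H12) (φ : TestI) : ℝ := -∫ x in Ioo (-1 : ℝ) 1, u x * deriv φ x

/-- The equation `-(1/π) pv 1/x * t + f t = u'` in the sense of distributions on `]-1,1[`. -/
def ContactEq (f : ℝ) (t : Hm12) (u : H12) : Prop :=
  ∀ φ : TestI, -(1 / Real.pi) * pvConv t φ
    + f * t (restr φ (φ.contDiff.of_le (by simp))) = distDeriv u φ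

end Contact

end

/-!
The equation `-(1/π) pv 1/x * t + f t = u'` is treated on the circle `ℝ / πℤ`, of which the line is
a chart through `x = tan θ`. The double integral of `((V x - V y) / (x - y))²` over the whole line is
conformally invariant: up to a factor it is the energy `∑ |n| |V̂(n)|²` of `V` as a function on the
circle (Douglas' formula, `circEnergy_eq_tsum` and `circEnergy_eq_gagliardo`). Functions of finite
energy modulo constants are therefore encoded by `c ∈ ℓ²(ℕ, ℂ)`, with `c k = 2 √(k+1) V̂(k+1)`
(`HasCoef`). In this encoding the energy form is `Re ⟨c, d⟩`, the conjugate function (Hilbert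
transform) is multiplication by `-i`, and the skew form `(V, W) ↦ ∫ V' W` is `Re ⟨i c, d⟩`.

Let `R : ℓ² → H^{1/2}(-1,1)` be the restriction to the interval (`restrictCoef`). It is onto modulo
constants, with bounded lifts, since `u` extends to `V` by `V(1/x) = u(x)`: the inversion preserves
the double integral, and `|1 - x y| ≥ |x - y|` on the square bounds the mixed terms
(`exists_restrictCoef_lift`). If `τ` is the Riesz representative of `t ∘ R`, then
`A t = R (π⁻¹ (1 - i f) τ)` modulo constants. As multiplication by `1 - i f` is coercive, Lax-Milgram
shows that `A` is an isomorphism (`exists_equiv_of_coercive`).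

The equation is checked on test functions `φ` (`contactEq_lhs`). On the line `log |x - y|` is the sum of
`log |sin (θ - η)|`, a function of `x` and a function of `y`; the last two disappear because `φ'` has
integral zero and `t` annihilates constants. The Fourier coefficients `-1 / (2 |n|)` of
`log |2 sin θ|` turn the principal value into multiplication by `-i` (`hasCoef_logPotential`).
Conversely, a solution `u` is determined up to a constant by the lemma of du Bois-Reymond.

For the sign, let `u = R c` up to the constant `a`, with `c = π⁻¹ (1 - i f) τ` the coefficients of `V`,
and let `d` be those of `W = max (V - a) 0`, which extends the positive part of `u`. Then
`⟨t, u⁺⟩ = Re ⟨τ, d⟩ = π / (1 + f²) (Re ⟨c, d⟩ + f Re ⟨i c, d⟩)`. The first term is at least `‖d‖²`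
because `V - W` and `W` have increments of the same sign (`HasCoef.exists_comp`); the second is the
integral of an exact derivative and vanishes (`inner_I_smul_comp`). In the case of equality `d = 0`, so
that `W`, and hence `u⁺`, is constant.
-/

noncomputable section

namespace Contact

open MeasureTheory Set
open scoped ENNReal ComplexConjugate InnerProductSpace

/-! ### The energy of a function on the circle -/

section Circle

open AddCircle

variable {T : ℝ} [hT : Fact (0 < T)]

theorem lintegral_sq_eq_tsum_fourierCoeff {F : AddCircle T → ℂ} (hF : MemLp F 2 haarAddCircle) :
    ∫⁻ θ, ‖F θ‖ₑ ^ 2 ∂haarAddCircle = ∑' n : ℤ, ‖fourierCoeff F n‖ₑ ^ 2 := by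
  have h := hasSum_sq_fourierCoeff (hF.toLp F)
  rw [fourierCoeff_congr_ae hF.coeFn_toLp] at h
  have h2 : ∫ t, ‖hF.toLp F t‖ ^ 2 ∂haarAddCircle = ∫ t, ‖F t‖ ^ 2 ∂haarAddCircle :=
    integral_congr_ae (by filter_upwards [hF.coeFn_toLp] with t ht; rw [ht])
  rw [h2] at h
  have h3 : ∫⁻ θ, ‖F θ‖ₑ ^ 2 ∂haarAddCircle
      = ENNReal.ofReal (∫ t, ‖F t‖ ^ 2 ∂haarAddCircle) := by
    rw [ofReal_integral_eq_lintegral_ofReal hF.integrable_norm_pow'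
      (Filter.Eventually.of_forall fun _ => by positivity)]
    refine lintegral_congr fun θ => ?_
    rw [ENNReal.ofReal_pow (norm_nonneg _), ofReal_norm]
  rw [h3, ← h.tsum_eq, ENNReal.ofReal_tsum_of_nonneg (fun _ => by positivity) h.summable]
  refine tsum_congr fun n => ?_
  rw [ENNReal.ofReal_pow (norm_nonneg _), ofReal_norm]

theorem fourierCoeff_translate (F : AddCircle T → ℂ) (h : AddCircle T) (n : ℤ) :
    fourierCoeff (fun θ => F (θ + h)) n = fourier n h * fourierCoeff F n := by
  unfold fourierCoeff
  rw [← integral_add_right_eq_self (fun t => fourier (-n) t • F t) h, ← integral_const_mul]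
  refine integral_congr_ae (Filter.Eventually.of_forall fun θ => ?_)
  have h1 : fourier n h * fourier (-n) h = 1 := by
    rw [← fourier_add, add_neg_cancel, fourier_zero]
  have h2 : fourier (-n) (θ + h) = fourier (-n) θ * fourier (-n) h := by
    simp only [fourier_apply, smul_add, AddCircle.toCircle_add, Circle.coe_mul]
  simp only [smul_eq_mul]
  rw [h2]
  linear_combination (-(fourier (-n) θ) * F (θ + h)) * h1

theorem fourierCoeff_sub {F G : AddCircle T → ℂ} (hF : Integrable F haarAddCircle)
    (hG : Integrable G haarAddCircle) (n : ℤ) :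
    fourierCoeff (fun θ => F θ - G θ) n = fourierCoeff F n - fourierCoeff G n := by
  unfold fourierCoeff
  rw [← integral_sub (hF.fourier_smul _) (hG.fourier_smul _)]
  simp only [smul_sub]

theorem fourier_nat_eq_pow {T : ℝ} (n : ℕ) (h : AddCircle T) : fourier (n : ℤ) h = fourier 1 h ^ n := by
  simp [fourier_apply, AddCircle.toCircle_nsmul]

theorem fourier_one_eq_one_iff (h : AddCircle T) : fourier 1 h = 1 ↔ h = 0 := by
  constructor
  · intro hh
    refine AddCircle.injective_toCircle hT.out.ne' ?_
    rw [fourier_one] at hh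
    rw [AddCircle.toCircle_zero]
    exact Subtype.ext hh
  · rintro rfl; exact fourier_eval_zero 1

theorem integrable_fourier (n : ℤ) :
    Integrable (fourier n : AddCircle T → ℂ) haarAddCircle :=
  (map_continuous (fourier n)).integrable_of_hasCompactSupport
    (HasCompactSupport.of_compactSpace _)

theorem haar_ae_ne_zero : ∀ᵐ h ∂(haarAddCircle (T := T)), h ≠ 0 := by
  rw [ae_iff]
  have h : (volume : Measure (AddCircle T)) {0} = 0 := by
    have := AddCircle.volume_closedBall (T := T) (x := 0) 0
    simpa using this
  rw [volume_eq_smul_haarAddCircle] at h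
  simpa [hT.out.not_ge] using h

/-- The Fejér-type integral `∫ |(eₙ - 1) / (e₁ - 1)|² = |n|`: the quotient is a sum of `|n|`
distinct characters. -/
theorem lintegral_fourier_sub_one_div (n : ℤ) :
    ∫⁻ h, ‖(fourier n h - 1 : ℂ)‖ₑ ^ 2 / ‖(fourier 1 h - 1 : ℂ)‖ₑ ^ 2 ∂(haarAddCircle (T := T))
      = n.natAbs := by
  have key : ∀ m : ℕ, ∫⁻ h, ‖(fourier (m : ℤ) h - 1 : ℂ)‖ₑ ^ 2 / ‖(fourier 1 h - 1 : ℂ)‖ₑ ^ 2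
      ∂(haarAddCircle (T := T)) = m := by
    intro m
    set S : AddCircle T → ℂ := ∑ j ∈ Finset.range m, (fourier (j : ℤ) : AddCircle T → ℂ) with hS
    have hSc : Continuous S := by
      rw [hS]
      exact (continuous_finsetSum (Finset.range m) fun j _ =>
        (fourier (T := T) (j : ℤ)).continuous).congr fun h => (Finset.sum_apply _ _ _).symm
    have h1 : ∫⁻ h, ‖(fourier (m : ℤ) h - 1 : ℂ)‖ₑ ^ 2 / ‖(fourier 1 h - 1 : ℂ)‖ₑ ^ 2
        ∂(haarAddCircle (T := T)) = ∫⁻ h, ‖S h‖ₑ ^ 2 ∂haarAddCircle := by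
      refine lintegral_congr_ae ?_
      filter_upwards [haar_ae_ne_zero] with h hh
      have hne : (fourier 1 h - 1 : ℂ) ≠ 0 := by
        rw [sub_ne_zero]; exact fun h' => hh ((fourier_one_eq_one_iff h).1 h')
      have hgeom : (fourier (m : ℤ) h - 1 : ℂ) = S h * (fourier 1 h - 1) := by
        rw [hS, Finset.sum_apply, fourier_nat_eq_pow, ← geom_sum_mul]
        simp only [fourier_nat_eq_pow]
      rw [hgeom, enorm_mul, mul_pow, ENNReal.mul_div_cancel_right]
      · simpa using hne
      · finiteness
    rw [h1, lintegral_sq_eq_tsum_fourierCoeff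
      (hSc.memLp_of_hasCompactSupport (HasCompactSupport.of_compactSpace _)), hS,
      fourierCoeff.sum _ _ fun j _ => integrable_fourier _]
    have h2 : ∀ n : ℤ, ‖(∑ j ∈ Finset.range m, fourierCoeff (fourier (j : ℤ) : AddCircle T → ℂ)) n‖ₑ ^ 2
        = ∑ j ∈ Finset.range m, (Pi.single (j : ℤ) 1 : ℤ → ℝ≥0∞) n := by
      intro n
      rw [Finset.sum_apply]
      simp only [fourierCoeff_fourier]
      by_cases hn : ∃ j ∈ Finset.range m, (j : ℤ) = n
      · obtain ⟨j, hj, rfl⟩ := hn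
        rw [Finset.sum_eq_single_of_mem j hj fun b _ hb => by
            rw [Pi.single_eq_of_ne]; exact_mod_cast hb.symm,
          Finset.sum_eq_single_of_mem j hj fun b _ hb => by
            rw [Pi.single_eq_of_ne]; exact_mod_cast hb.symm]
        simp
      · push Not at hn
        rw [Finset.sum_eq_zero fun j hj => by rw [Pi.single_eq_of_ne (hn j hj).symm],
          Finset.sum_eq_zero fun j hj => by rw [Pi.single_eq_of_ne (hn j hj).symm]]
        simp
    simp_rw [h2]
    rw [Summable.tsum_finsetSum fun _ _ => ENNReal.summable]
    simp [tsum_pi_single]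
  obtain ⟨m, rfl | rfl⟩ := n.eq_nat_or_neg
  · simpa using key m
  · rw [Int.natAbs_neg, Int.natAbs_natCast, ← key m]
    refine lintegral_congr fun h => ?_
    have : (fourier (-(m : ℤ)) h - 1 : ℂ) = conj (fourier (m : ℤ) h - 1) := by
      rw [fourier_neg]; simp
    rw [this, RCLike.enorm_conj]

/-- The Dirichlet (Douglas) energy of a function on the circle. With `h = θ - η` its integrand is
`‖F θ - F η‖² / ‖e₁ θ - e₁ η‖²`; the diagonal is negligible. -/
def circEnergy (F : AddCircle T → ℂ) : ℝ≥0∞ :=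
  ∫⁻ h, ∫⁻ θ, ‖F (θ + h) - F θ‖ₑ ^ 2 / ‖(fourier 1 h - 1 : ℂ)‖ₑ ^ 2 ∂haarAddCircle ∂haarAddCircle

/-- Douglas' formula: Parseval for each difference `F (· + h) - F`, then integration in `h`. -/
theorem circEnergy_eq_tsum {F : AddCircle T → ℂ} (hF : MemLp F 2 haarAddCircle) :
    circEnergy F = ∑' n : ℤ, (n.natAbs : ℝ≥0∞) * ‖fourierCoeff F n‖ₑ ^ 2 := by
  have h1 : ∀ h : AddCircle T, ∫⁻ θ, ‖F (θ + h) - F θ‖ₑ ^ 2 / ‖(fourier 1 h - 1 : ℂ)‖ₑ ^ 2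
      ∂haarAddCircle = ∑' n : ℤ, ‖(fourier n h - 1 : ℂ)‖ₑ ^ 2 / ‖(fourier 1 h - 1 : ℂ)‖ₑ ^ 2
        * ‖fourierCoeff F n‖ₑ ^ 2 := by
    intro h
    have hFh : MemLp (fun θ => F (θ + h)) 2 haarAddCircle :=
      hF.comp_measurePreserving (measurePreserving_add_right haarAddCircle h)
    have hd : MemLp (fun θ => F (θ + h) - F θ) 2 haarAddCircle := hFh.sub hF
    simp_rw [div_eq_mul_inv]
    rw [lintegral_mul_const'' _ (hd.1.enorm.pow_const 2), lintegral_sq_eq_tsum_fourierCoeff hd,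
      ← ENNReal.tsum_mul_right]
    refine tsum_congr fun n => ?_
    rw [fourierCoeff_sub (hFh.integrable one_le_two) (hF.integrable one_le_two),
      fourierCoeff_translate]
    rw [show fourier n h * fourierCoeff F n - fourierCoeff F n
      = (fourier n h - 1) * fourierCoeff F n by ring, enorm_mul, mul_pow]
    ring
  unfold circEnergy
  simp_rw [h1]
  rw [lintegral_tsum]
  · refine tsum_congr fun n => ?_
    rw [lintegral_mul_const'', lintegral_fourier_sub_one_div]
    fun_prop
  · intro n
    fun_prop

end Circle

/-! ### Coefficients of functions of finite energy -/

section Coefficients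

open AddCircle

variable {T : ℝ} [hT : Fact (0 < T)]

/-- The real Hilbert space `ℓ²(ℕ, ℂ)` of renormalised Fourier coefficients. -/
abbrev Coef : Type := lp (fun _ : ℕ => ℂ) 2

theorem Coef.enorm_sq (c : Coef) : ‖c‖ₑ ^ 2 = ∑' k, ‖c k‖ₑ ^ 2 := by
  have h := lp.hasSum_norm (p := 2) (by norm_num) c
  simp only [ENNReal.toReal_ofNat, Real.rpow_ofNat] at h
  rw [← ofReal_norm, ← ENNReal.ofReal_pow (norm_nonneg _), ← h.tsum_eq,
    ENNReal.ofReal_tsum_of_nonneg (fun _ => by positivity) h.summable]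
  refine tsum_congr fun n => ?_
  rw [ENNReal.ofReal_pow (norm_nonneg _), ofReal_norm]

/-- The complexification of a real function. -/
abbrev cx {α : Type*} (V : α → ℝ) : α → ℂ := fun θ => (V θ : ℂ)

/-- The real function `V` on the circle is square integrable and
`V = Re ∑ₖ (k + 1)^{-1/2} c k e_{k+1}` up to an additive constant. With this normalisation of the
coefficients the energy of `V` is half the square of the norm of `c`. -/
def HasCoef (V : AddCircle T → ℝ) (c : Coef) : Prop :=
  MemLp V 2 haarAddCircle ∧
    ∀ k : ℕ, c k = (2 * √(k + 1 : ℝ) : ℝ) * fourierCoeff (cx V) (k + 1)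

theorem fourierCoeff_cx_neg (V : AddCircle T → ℝ) (n : ℤ) :
    fourierCoeff (cx V) (-n) = conj (fourierCoeff (cx V) n) := by
  unfold fourierCoeff
  rw [← integral_conj]
  refine integral_congr_ae (Filter.Eventually.of_forall fun θ => ?_)
  simp only [smul_eq_mul, map_mul, Complex.conj_ofReal, fourier_neg, Complex.conj_conj]

theorem memLp_cx {V : AddCircle T → ℝ} (hV : MemLp V 2 haarAddCircle) :
    MemLp (cx V) 2 haarAddCircle := hV.ofReal

theorem integrable_cx {V : AddCircle T → ℝ} (hV : MemLp V 2 haarAddCircle) :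
    Integrable (cx V) haarAddCircle := (memLp_cx hV).integrable one_le_two

theorem two_mul_circEnergy_eq_tsum {V : AddCircle T → ℝ} (hV : MemLp V 2 haarAddCircle) :
    2 * circEnergy (cx V)
      = ∑' k : ℕ, ‖(((2 * √(k + 1 : ℝ) : ℝ) : ℂ) * fourierCoeff (cx V) (k + 1))‖ₑ ^ 2 := by
  have hk : ∀ k : ℕ, ‖(((2 * √(k + 1 : ℝ) : ℝ) : ℂ) * fourierCoeff (cx V) (k + 1))‖ₑ ^ 2
      = 4 * (((k + 1 : ℕ) : ℝ≥0∞) * ‖fourierCoeff (cx V) (k + 1)‖ₑ ^ 2) := by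
    intro k
    rw [enorm_mul, mul_pow, ← mul_assoc]
    congr 1
    rw [← ofReal_norm, Complex.norm_real, Real.norm_of_nonneg (by positivity),
      ← ENNReal.ofReal_pow (by positivity), mul_pow, Real.sq_sqrt (by positivity),
      ENNReal.ofReal_mul (by norm_num)]
    norm_num
    rw [show ((k : ℝ) + 1) = ((k + 1 : ℕ) : ℝ) by push_cast; ring, ENNReal.ofReal_natCast]
    push_cast; rfl
  simp_rw [hk]
  rw [circEnergy_eq_tsum (memLp_cx hV), ENNReal.tsum_mul_left,
    tsum_of_add_one_of_neg_add_one ENNReal.summable ENNReal.summable]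
  have h2 : ∀ k : ℕ, ((-((k : ℤ) + 1)).natAbs : ℝ≥0∞) * ‖fourierCoeff (cx V) (-((k : ℤ) + 1))‖ₑ ^ 2
      = ((k + 1 : ℕ) : ℝ≥0∞) * ‖fourierCoeff (cx V) (k + 1)‖ₑ ^ 2 := by
    intro k
    rw [fourierCoeff_cx_neg, RCLike.enorm_conj, Int.natAbs_neg]
    rfl
  have h3 : ∀ k : ℕ, (((k : ℤ) + 1).natAbs : ℝ≥0∞) * ‖fourierCoeff (cx V) ((k : ℤ) + 1)‖ₑ ^ 2
      = ((k + 1 : ℕ) : ℝ≥0∞) * ‖fourierCoeff (cx V) (k + 1)‖ₑ ^ 2 := fun k => rfl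
  simp_rw [h2, h3]
  simp only [Int.natAbs_zero, Nat.cast_zero, zero_mul, add_zero]
  rw [← two_mul, ← mul_assoc]
  norm_num

theorem HasCoef.two_mul_circEnergy {V : AddCircle T → ℝ} {c : Coef} (h : HasCoef V c) :
    2 * circEnergy (cx V) = ‖c‖ₑ ^ 2 := by
  rw [two_mul_circEnergy_eq_tsum h.1, Coef.enorm_sq]
  exact tsum_congr fun k => by rw [h.2 k]

theorem exists_hasCoef {V : AddCircle T → ℝ} (hV : MemLp V 2 haarAddCircle)
    (hE : circEnergy (cx V) ≠ ∞) : ∃ c : Coef, HasCoef V c := by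
  have h := two_mul_circEnergy_eq_tsum hV
  have hfin : 2 * circEnergy (cx V) ≠ ∞ := ENNReal.mul_ne_top (by norm_num) hE
  rw [h] at hfin
  have hmem : Memℓp (fun k : ℕ => (((2 * √(k + 1 : ℝ) : ℝ) : ℂ) * fourierCoeff (cx V) (k + 1)))
      2 := by
    refine memℓp_gen ?_
    simp only [ENNReal.toReal_ofNat, Real.rpow_ofNat]
    refine (ENNReal.summable_toReal hfin).congr fun k => ?_
    simp
  exact ⟨⟨_, hmem⟩, hV, fun k => rfl⟩

theorem hasCoef_congr {V W : AddCircle T → ℝ} {c : Coef} (h : HasCoef V c)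
    (hVW : V =ᵐ[haarAddCircle] W) : HasCoef W c := by
  refine ⟨h.1.ae_eq hVW, fun k => ?_⟩
  rw [h.2 k, fourierCoeff_congr_ae (f := cx V) (g := cx W)]
  filter_upwards [hVW] with θ hθ
  simp [hθ]

theorem HasCoef.add {V W : AddCircle T → ℝ} {c d : Coef} (h : HasCoef V c) (h' : HasCoef W d) :
    HasCoef (V + W) (c + d) := by
  refine ⟨h.1.add h'.1, fun k => ?_⟩
  have : cx (V + W) = cx V + cx W := by funext θ; simp [cx]
  rw [this, fourierCoeff.add (integrable_cx h.1) (integrable_cx h'.1), Pi.add_apply, mul_add,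
    ← h.2 k, ← h'.2 k]
  rfl

theorem HasCoef.smul {V : AddCircle T → ℝ} {c : Coef} (h : HasCoef V c) (a : ℝ) :
    HasCoef (a • V) (a • c) := by
  refine ⟨h.1.const_smul a, fun k => ?_⟩
  have : cx (a • V) = (a : ℂ) • cx V := by funext θ; simp [cx]
  rw [this, fourierCoeff.const_smul, smul_eq_mul, mul_left_comm, ← h.2 k]
  simp

theorem HasCoef.sub {V W : AddCircle T → ℝ} {c d : Coef} (h : HasCoef V c) (h' : HasCoef W d) :
    HasCoef (V - W) (c - d) := by
  have := h.add (h'.smul (-1))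
  simpa [sub_eq_add_neg] using this

theorem hasCoef_const (a : ℝ) : HasCoef (fun _ : AddCircle T => a) 0 := by
  refine ⟨memLp_const a, fun k => ?_⟩
  have : cx (fun _ : AddCircle T => a) = (a : ℂ) • (fourier 0 : AddCircle T → ℂ) := by
    funext θ; simp
  rw [this, fourierCoeff.const_smul, fourierCoeff_fourier, Pi.single_eq_of_ne (by omega)]
  simp

/-- A function of zero energy is constant: only its mean survives in Parseval's identity. -/
theorem HasCoef.ae_const {V : AddCircle T → ℝ} (h : HasCoef V 0) :
    ∃ a : ℝ, ∀ᵐ θ ∂haarAddCircle, V θ = a := by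
  have hz : ∀ k : ℕ, fourierCoeff (cx V) (k + 1) = 0 := by
    intro k
    have h1 := (h.2 k).symm
    have h2 : (((2 * √(k + 1 : ℝ) : ℝ) : ℂ)) ≠ 0 := by
      rw [Complex.ofReal_ne_zero]; positivity
    exact (mul_eq_zero.1 h1).resolve_left h2
  set a : ℝ := (fourierCoeff (cx V) 0).re
  have ha : fourierCoeff (cx V) 0 = a := by
    have h0 := fourierCoeff_cx_neg V 0
    rw [neg_zero] at h0
    exact (Complex.conj_eq_iff_re.1 h0.symm).symm
  have hD : MemLp (fun θ => cx V θ - (a : ℂ)) 2 haarAddCircle :=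
    (memLp_cx h.1).sub (memLp_const (a : ℂ))
  have hs := lintegral_sq_eq_tsum_fourierCoeff hD
  have hc : (fun _ : AddCircle T => (a : ℂ)) = (a : ℂ) • (fourier 0 : AddCircle T → ℂ) := by
    funext θ; simp
  have hzero : ∀ n : ℤ, fourierCoeff (fun θ => cx V θ - (a : ℂ)) n = 0 := by
    intro n
    rw [fourierCoeff_sub (G := fun _ => (a : ℂ)) (integrable_cx h.1) (integrable_const _), hc,
      fourierCoeff.const_smul, fourierCoeff_fourier]
    rcases lt_trichotomy n 0 with hn | rfl | hn
    · obtain ⟨k, rfl⟩ : ∃ k : ℕ, n = -((k : ℤ) + 1) := ⟨(-n - 1).toNat, by omega⟩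
      rw [fourierCoeff_cx_neg, hz, Pi.single_eq_of_ne (by omega)]; simp
    · rw [ha]; simp
    · obtain ⟨k, rfl⟩ : ∃ k : ℕ, n = (k : ℤ) + 1 := ⟨(n - 1).toNat, by omega⟩
      rw [hz, Pi.single_eq_of_ne (by omega)]; simp
  simp_rw [hzero] at hs
  rw [show (∑' _ : ℤ, ‖(0 : ℂ)‖ₑ ^ 2) = 0 by simp,
    lintegral_eq_zero_iff' (hD.1.enorm.pow_const 2)] at hs
  refine ⟨a, ?_⟩
  filter_upwards [hs] with θ hθ
  have : (V θ : ℂ) - a = 0 := by simpa using hθ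
  exact Complex.ofReal_injective (sub_eq_zero.1 this)

/-- A function of mean zero is bounded in `L²` by its energy. -/
theorem lintegral_sq_le_circEnergy {V : AddCircle T → ℝ} (hV : MemLp V 2 haarAddCircle)
    (h0 : fourierCoeff (cx V) 0 = 0) : ∫⁻ θ, ‖V θ‖ₑ ^ 2 ∂haarAddCircle ≤ circEnergy (cx V) := by
  have h1 := lintegral_sq_eq_tsum_fourierCoeff (memLp_cx hV)
  have h2 : ∀ θ, ‖cx V θ‖ₑ = ‖V θ‖ₑ := fun θ => by
    rw [← ofReal_norm, ← ofReal_norm, Complex.norm_real]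
  simp_rw [h2] at h1
  rw [h1, circEnergy_eq_tsum (memLp_cx hV)]
  refine ENNReal.tsum_le_tsum fun n => ?_
  rcases eq_or_ne n 0 with rfl | hn
  · simp [h0]
  · refine le_mul_of_one_le_left' ?_
    exact_mod_cast Nat.one_le_iff_ne_zero.2 (Int.natAbs_ne_zero.2 hn)

/-- Every sequence of coefficients is realised by a function of mean zero. -/
theorem exists_fun_hasCoef (c : Coef) :
    ∃ V : Lp ℝ 2 (haarAddCircle (T := T)), HasCoef V c ∧ fourierCoeff (cx V) 0 = 0 := by
  -- `V = Re F` with `F = ∑ₖ (k + 1)^{-1/2} c k e_{k+1}`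
  set a : ℤ → ℂ := fun n => if 0 < n then c (n - 1).toNat / (√(n : ℝ) : ℝ) else 0 with ha
  have ha1 : ∀ k : ℕ, a (k + 1) = c k / (√(k + 1 : ℝ) : ℝ) := by
    intro k
    simp only [ha]
    rw [if_pos (by omega)]
    simp
  have ha0 : ∀ n : ℤ, n ≤ 0 → a n = 0 := fun n hn => by simp only [ha]; rw [if_neg (by omega)]
  have hmem : Memℓp a 2 := by
    refine memℓp_gen ?_
    simp only [ENNReal.toReal_ofNat, Real.rpow_ofNat]
    have hinj : Function.Injective (fun k : ℕ => (k : ℤ) + 1) := fun _ _ h => by simpa using h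
    rw [← hinj.summable_iff]
    · have h := lp.hasSum_norm (p := 2) (by norm_num) c
      simp only [ENNReal.toReal_ofNat, Real.rpow_ofNat] at h
      refine Summable.of_nonneg_of_le (fun _ => sq_nonneg _) (fun k => ?_) h.summable
      simp only [Function.comp_apply, ha1, norm_div]
      have : 1 ≤ ‖((√(k + 1 : ℝ) : ℝ) : ℂ)‖ := by
        rw [Complex.norm_real, Real.norm_of_nonneg (by positivity), Real.one_le_sqrt]
        linarith [(Nat.cast_nonneg k : (0 : ℝ) ≤ k)]
      gcongr
      exact div_le_self (norm_nonneg _) this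
    · intro n hn
      have : n ≤ 0 := by
        by_contra h
        exact hn ⟨(n - 1).toNat, by simp only; omega⟩
      simp [ha0 n this]
  set F : Lp ℂ 2 (haarAddCircle (T := T)) := fourierBasis.repr.symm ⟨a, hmem⟩ with hF
  have hFc : ∀ n, fourierCoeff F n = a n := by
    intro n
    rw [← fourierBasis_repr, hF, LinearIsometryEquiv.apply_symm_apply]
  have hFm : MemLp (F : AddCircle T → ℂ) 2 haarAddCircle := Lp.memLp F
  have hV : MemLp (fun θ => (F θ).re) 2 haarAddCircle := hFm.re
  have hco : ∀ n, fourierCoeff (cx fun θ => (F θ).re) n = (a n + conj (a (-n))) / 2 := by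
    intro n
    rw [← hFc, ← hFc]
    unfold fourierCoeff
    have hi := hFm.integrable one_le_two
    rw [← integral_conj, ← integral_add (hi.fourier_smul _), ← integral_div]
    · refine integral_congr_ae (Filter.Eventually.of_forall fun θ => ?_)
      simp only [smul_eq_mul, map_mul, neg_neg, fourier_neg, cx]
      rw [Complex.re_eq_add_conj]
      ring
    · exact Complex.conjCLE.toContinuousLinearMap.integrable_comp (hi.fourier_smul (- -n))
  have hae := hV.coeFn_toLp
  have hcx : cx (hV.toLp _) =ᵐ[haarAddCircle] cx (fun θ => (F θ).re) := by
    filter_upwards [hae] with θ hθ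
    simp [hθ]
  refine ⟨hV.toLp _, ⟨Lp.memLp _, fun k => ?_⟩, ?_⟩
  · rw [fourierCoeff_congr_ae hcx, hco, ha1, ha0 _ (by omega)]
    have : (((√(k + 1 : ℝ) : ℝ) : ℂ)) ≠ 0 := by
      rw [Complex.ofReal_ne_zero]; positivity
    push_cast
    field_simp
    simp
  · rw [fourierCoeff_congr_ae hcx, hco, neg_zero, ha0 0 le_rfl]
    simp

end Coefficients

/-! ### Coercive operators and the isomorphism -/

theorem H0star_apply_eq {t : Hm12} (ht : t ∈ H0star) {v w : H12}
    (h : v - w ∈ Submodule.span ℝ {one}) : t v = t w := by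
  obtain ⟨a, ha⟩ := Submodule.mem_span_singleton.1 h
  rw [← sub_eq_zero, ← map_sub, ← ha, map_smul, show t one = 0 from ht, smul_zero]

theorem toH0_eq_iff {v w : H12} : toH0 v = toH0 w ↔ v - w ∈ Submodule.span ℝ {one} :=
  Submodule.Quotient.eq _

section Abstract

variable {H : Type*} [NormedAddCommGroup H] [InnerProductSpace ℝ H] [CompleteSpace H]

/-- The Riesz representative `τ` of `t ∘ R`: `⟪τ, d⟫ = t (R d)`. -/
def rieszPull (R : H →L[ℝ] H12) : Hm12 →ₗ[ℝ] H where
  toFun t := (InnerProductSpace.toDual ℝ H).symm (t.comp R)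
  map_add' s t := by rw [ContinuousLinearMap.add_comp, map_add]
  map_smul' a t := by
    rw [ContinuousLinearMap.smul_comp]
    simp

theorem inner_rieszPull (R : H →L[ℝ] H12) (t : Hm12) (d : H) :
    ⟪rieszPull R t, d⟫_ℝ = t (R d) :=
  InnerProductSpace.toDual_symm_apply

theorem norm_rieszPull_le (R : H →L[ℝ] H12) (t : Hm12) : ‖rieszPull R t‖ ≤ ‖R‖ * ‖t‖ := by
  change ‖(InnerProductSpace.toDual ℝ H).symm (t.comp R)‖ ≤ _
  rw [LinearIsometryEquiv.norm_map, mul_comm]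
  exact ContinuousLinearMap.opNorm_comp_le t R

/-- Let `R : H → H^{1/2}` be onto modulo constants, with bounded lifts. An element of `H` orthogonal
to everything that `R` maps to the constants is the Riesz representative of an element of `H₀*`. -/
theorem exists_H0star_of_orthogonal (R : H →L[ℝ] H12) {C : ℝ}
    (hlift : ∀ w : H12, ∃ d : H, R d - w ∈ Submodule.span ℝ {one} ∧ ‖d‖ ≤ C * ‖w‖)
    (m : H) (hm : ∀ d : H, R d ∈ Submodule.span ℝ {one} → ⟪m, d⟫_ℝ = 0) :
    ∃ t ∈ H0star, rieszPull R t = m := by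
  choose l hl hlC using hlift
  have hwd : ∀ (w : H12) (d : H), R d - w ∈ Submodule.span ℝ {one} → ⟪m, l w⟫_ℝ = ⟪m, d⟫_ℝ := by
    intro w d hd
    rw [← sub_eq_zero, ← inner_sub_right]
    apply hm
    rw [map_sub, ← sub_sub_sub_cancel_right _ _ w]
    exact Submodule.sub_mem _ (hl w) hd
  let t₀ : H12 →ₗ[ℝ] ℝ :=
    { toFun := fun w => ⟪m, l w⟫_ℝ
      map_add' := fun v w => by
        rw [hwd (v + w) (l v + l w), inner_add_right]
        rw [map_add, add_sub_add_comm]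
        exact Submodule.add_mem _ (hl v) (hl w)
      map_smul' := fun a w => by
        rw [hwd (a • w) (a • l w), inner_smul_right]
        · rfl
        rw [map_smul, ← smul_sub]
        exact Submodule.smul_mem _ _ (hl w) }
  let t : Hm12 := t₀.mkContinuous (‖m‖ * C) fun w => by
    refine (norm_inner_le_norm m (l w)).trans ?_
    rw [mul_assoc]
    exact mul_le_mul_of_nonneg_left (hlC w) (norm_nonneg _)
  have ht : ∀ w, t w = ⟪m, l w⟫_ℝ := fun w => rfl
  refine ⟨t, ?_, ?_⟩
  · change t one = 0
    rw [ht, hwd one 0, inner_zero_right]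
    rw [map_zero, zero_sub]
    exact Submodule.neg_mem _ (Submodule.mem_span_singleton_self _)
  · refine ext_inner_right ℝ fun d => ?_
    rw [inner_rieszPull, ht, hwd (R d) d]
    rw [sub_self]
    exact Submodule.zero_mem _

/-- If `L` is coercive on the Hilbert space `H` and `R : H → H^{1/2}` is onto modulo constants with
bounded lifts, then `t ↦ R L R* t` is an isomorphism from `H₀*` onto `H₀`. Surjectivity is
Lax-Milgram on the orthogonal complement of `{d | R d is constant}`. -/
theorem exists_equiv_of_coercive (R : H →L[ℝ] H12) {C : ℝ}
    (hlift : ∀ w : H12, ∃ d : H, R d - w ∈ Submodule.span ℝ {one} ∧ ‖d‖ ≤ C * ‖w‖)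
    (L : H →L[ℝ] H) {κ : ℝ} (hκ : 0 < κ) (hL : ∀ d, κ * (‖d‖ * ‖d‖) ≤ ⟪L d, d⟫_ℝ) :
    ∃ A : H0star ≃L[ℝ] H0, ∀ t : H0star, A t = toH0 (R (L (rieszPull R t))) := by
  let A₀ : H0star →ₗ[ℝ] H0 :=
    (Submodule.mkQ (Submodule.span ℝ {one})) ∘ₗ R.toLinearMap ∘ₗ L.toLinearMap ∘ₗ
      (rieszPull R) ∘ₗ H0star.subtype
  have hA₀ : ∀ t : H0star, A₀ t = toH0 (R (L (rieszPull R t))) := fun t => rfl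
  -- `t` is controlled by its Riesz representative
  have hC : ∀ t : H0star, ‖t‖ ≤ |C| * ‖rieszPull R t‖ := by
    intro t
    refine ContinuousLinearMap.opNorm_le_bound (t : Hm12) (by positivity) fun w => ?_
    obtain ⟨d, hd, hdC⟩ := hlift w
    rw [← H0star_apply_eq t.2 hd, ← inner_rieszPull]
    refine (norm_inner_le_norm _ _).trans ?_
    calc ‖rieszPull R t‖ * ‖d‖ ≤ ‖rieszPull R t‖ * (|C| * ‖w‖) := by
          gcongr
          exact hdC.trans (mul_le_mul_of_nonneg_right (le_abs_self C) (norm_nonneg _))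
      _ = |C| * ‖rieszPull R t‖ * ‖w‖ := by ring
  have hlow : ∀ t : H0star, κ * (‖rieszPull R t‖ * ‖rieszPull R t‖) ≤ ‖t‖ * ‖A₀ t‖ := by
    intro t
    refine le_of_forall_pos_le_add fun ε hε => ?_
    obtain ⟨w, hw, hwn⟩ := (Submodule.Quotient.norm_mk_lt (S := Submodule.span ℝ {one}) (A₀ t)
      (show 0 < ε / (‖t‖ + 1) by positivity))
    have h1 : (t : Hm12) w = ⟪L (rieszPull R t), rieszPull R t⟫_ℝ := by
      rw [real_inner_comm, inner_rieszPull]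
      refine H0star_apply_eq t.2 (toH0_eq_iff.1 ?_)
      rw [← hA₀]; exact hw
    calc κ * (‖rieszPull R t‖ * ‖rieszPull R t‖) ≤ (t : Hm12) w := by rw [h1]; exact hL _
      _ ≤ ‖(t : Hm12) w‖ := le_abs_self _
      _ ≤ ‖t‖ * ‖w‖ := (t : Hm12).le_opNorm w
      _ ≤ ‖t‖ * (‖A₀ t‖ + ε / (‖t‖ + 1)) := by gcongr
      _ = ‖t‖ * ‖A₀ t‖ + ε * (‖t‖ / (‖t‖ + 1)) := by ring
      _ ≤ ‖t‖ * ‖A₀ t‖ + ε := by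
          gcongr
          refine mul_le_of_le_one_right hε.le ?_
          rw [div_le_one (by positivity)]
          linarith
  have hinv : ∀ t : H0star, ‖t‖ ≤ (C ^ 2 / κ) * ‖A₀ t‖ := by
    intro t
    rcases eq_or_lt_of_le (norm_nonneg t) with h0 | h0
    · rw [← h0]; positivity
    have h1 : ‖t‖ * ‖t‖ ≤ ‖t‖ * ((C ^ 2 / κ) * ‖A₀ t‖) := by
      calc ‖t‖ * ‖t‖ ≤ (|C| * ‖rieszPull R t‖) * (|C| * ‖rieszPull R t‖) :=
            mul_self_le_mul_self h0.le (hC t)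
        _ = (C ^ 2 / κ) * (κ * (‖rieszPull R t‖ * ‖rieszPull R t‖)) := by
            rw [← sq_abs C]; field_simp
        _ ≤ (C ^ 2 / κ) * (‖t‖ * ‖A₀ t‖) :=
            mul_le_mul_of_nonneg_left (hlow t) (by positivity)
        _ = _ := by ring
    exact le_of_mul_le_mul_left h1 h0
  have hinj : Function.Injective A₀ := by
    rw [injective_iff_map_eq_zero]
    intro t ht
    have := hinv t
    rw [ht, norm_zero, mul_zero] at this
    exact Subtype.ext ((norm_le_zero_iff (a := (t : Hm12))).1 this)
  have hsurj : Function.Surjective A₀ := by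
    intro q
    obtain ⟨w, rfl⟩ := Submodule.Quotient.mk_surjective _ q
    obtain ⟨d₀, hd₀, -⟩ := hlift w
    let N : Submodule ℝ H := (Submodule.span ℝ {one}).comap R.toLinearMap
    have hNc : IsClosed (N : Set H) := by
      have h1 : IsClosed ((Submodule.span ℝ {one} : Submodule ℝ H12) : Set H12) :=
        Submodule.closed_of_finiteDimensional _
      exact h1.preimage R.continuous
    have : CompleteSpace N := hNc.completeSpace_coe
    let B : Nᗮ →L[ℝ] Nᗮ →L[ℝ] ℝ :=
      (innerSL ℝ (E := H)).bilinearComp (L ∘L Nᗮ.subtypeL) Nᗮ.subtypeL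
    have hB : ∀ x y : Nᗮ, B x y = ⟪L x, (y : H)⟫_ℝ := fun x y => rfl
    have hcoer : IsCoercive B := ⟨κ, hκ, fun x => by
      rw [hB, mul_assoc]; exact hL x⟩
    let g : Nᗮ := (InnerProductSpace.toDual ℝ Nᗮ).symm ((innerSL ℝ d₀) ∘L Nᗮ.subtypeL)
    have hg : ∀ y : Nᗮ, ⟪g, y⟫_ℝ = ⟪d₀, (y : H)⟫_ℝ := fun y => by
      simp only [g, InnerProductSpace.toDual_symm_apply]
      rfl
    let m : Nᗮ := hcoer.continuousLinearEquivOfBilin.symm g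
    have hm : ∀ y : Nᗮ, ⟪L m, (y : H)⟫_ℝ = ⟪d₀, (y : H)⟫_ℝ := by
      intro y
      rw [← hB, ← hg, ← hcoer.continuousLinearEquivOfBilin_apply]
      simp [m]
    have hmem : L m - d₀ ∈ N := by
      refine (Submodule.orthogonal_orthogonal N).le ?_
      rw [Submodule.mem_orthogonal']
      intro y hy
      rw [inner_sub_left, hm ⟨y, hy⟩, sub_self]
    obtain ⟨t, ht, htm⟩ := exists_H0star_of_orthogonal R hlift (m : H)
      (fun d hd => Submodule.inner_left_of_mem_orthogonal (K := N) hd m.2)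
    refine ⟨⟨t, ht⟩, ?_⟩
    rw [hA₀, htm]
    refine toH0_eq_iff.2 ?_
    have h2 : R (L m) - R d₀ ∈ Submodule.span ℝ {one} := by
      rw [← map_sub]; exact hmem
    have := Submodule.add_mem _ h2 hd₀
    rwa [sub_add_sub_cancel] at this
  let e : H0star ≃ₗ[ℝ] H0 := LinearEquiv.ofBijective A₀ ⟨hinj, hsurj⟩
  have hcont : Continuous e := by
    refine AddMonoidHomClass.continuous_of_bound e (‖R‖ * ‖L‖ * ‖R‖) fun t => ?_
    change ‖A₀ t‖ ≤ _
    rw [hA₀]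
    calc ‖toH0 (R (L (rieszPull R t)))‖ ≤ ‖R (L (rieszPull R t))‖ :=
          Submodule.Quotient.norm_mk_le _ _
      _ ≤ ‖R‖ * (‖L‖ * (‖R‖ * ‖(t : Hm12)‖)) := by
          refine (R.le_opNorm _).trans ?_
          gcongr
          refine (L.le_opNorm _).trans ?_
          gcongr
          exact norm_rieszPull_le R t
      _ = _ := by rw [Submodule.coe_norm]; ring
  have hcont' : Continuous e.symm := by
    refine AddMonoidHomClass.continuous_of_bound e.symm (C ^ 2 / κ) fun q => ?_
    obtain ⟨t, rfl⟩ := e.surjective q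
    rw [LinearEquiv.symm_apply_apply]
    exact hinv t
  exact ⟨{ e with continuous_toFun := hcont, continuous_invFun := hcont' }, hA₀⟩

end Abstract

/-! ### The line as a chart of the circle -/

open AddCircle

instance factPiPos : Fact (0 < Real.pi) := ⟨Real.pi_pos⟩

/-- The circle `ℝ / πℤ`, the projective line. -/
abbrev Circ : Type := AddCircle Real.pi

/-- The chart `x ↦ arctan x` from the line to the circle; its image omits one point. -/
def chart (x : ℝ) : Circ := (Real.arctan x : ℝ)

/-- The density of the uniform probability of the circle in the chart. -/
def cauchyDensity (x : ℝ) : ℝ := (Real.pi * (1 + x ^ 2))⁻¹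

theorem cauchyDensity_pos (x : ℝ) : 0 < cauchyDensity x := by
  have := Real.pi_pos
  unfold cauchyDensity; positivity

theorem continuous_cauchyDensity : Continuous cauchyDensity := by
  unfold cauchyDensity
  refine Continuous.inv₀ (by fun_prop) fun x => ?_
  have := Real.pi_pos
  positivity

theorem measurable_ofReal_cauchyDensity :
    Measurable fun x => ENNReal.ofReal (cauchyDensity x) :=
  continuous_cauchyDensity.measurable.ennreal_ofReal

theorem measurable_chart : Measurable chart :=
  AddCircle.measurable_mk'.comp Real.measurable_arctan

theorem lintegral_circ_eq (g : Circ → ℝ≥0∞) :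
    ∫⁻ θ, g θ ∂haarAddCircle = ∫⁻ x, ENNReal.ofReal (cauchyDensity x) * g (chart x) := by
  have h1 : ∫⁻ θ, g θ = ENNReal.ofReal Real.pi * ∫⁻ θ, g θ ∂haarAddCircle := by
    rw [volume_eq_smul_haarAddCircle, lintegral_smul_measure, smul_eq_mul]
  have h2 : ∫⁻ θ, g θ = ∫⁻ x, ENNReal.ofReal |1 / (1 + x ^ 2)| * g (chart x) := by
    rw [← AddCircle.lintegral_preimage Real.pi (-(Real.pi / 2)),
      show -(Real.pi / 2) + Real.pi = Real.pi / 2 by ring, ← restrict_Ioo_eq_restrict_Ioc,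
      ← Real.range_arctan, ← image_univ,
      lintegral_image_eq_lintegral_abs_deriv_mul MeasurableSet.univ
        (fun x _ => (Real.hasDerivAt_arctan x).hasDerivWithinAt)
        Real.arctan_injective.injOn, Measure.restrict_univ]
    rfl
  have h3 : ∀ x : ℝ, ENNReal.ofReal |1 / (1 + x ^ 2)| * g (chart x)
      = ENNReal.ofReal Real.pi * (ENNReal.ofReal (cauchyDensity x) * g (chart x)) := by
    intro x
    rw [← mul_assoc, ← ENNReal.ofReal_mul Real.pi_pos.le, abs_of_nonneg (by positivity)]
    congr 2
    unfold cauchyDensity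
    field_simp
  simp_rw [h3] at h2
  rw [h1, lintegral_const_mul' _ _ ENNReal.ofReal_ne_top] at h2
  refine (ENNReal.mul_right_inj ?_ ENNReal.ofReal_ne_top).1 h2
  simpa using Real.pi_pos

theorem haar_eq_map_chart : (haarAddCircle : Measure Circ)
    = (volume.withDensity fun x => ENNReal.ofReal (cauchyDensity x)).map chart := by
  refine Measure.ext_of_lintegral _ fun g hg => ?_
  rw [lintegral_map hg measurable_chart, lintegral_circ_eq]
  exact (lintegral_withDensity_eq_lintegral_mul _ measurable_ofReal_cauchyDensity
    (hg.comp measurable_chart)).symm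

theorem quasiMeasurePreserving_chart :
    Measure.QuasiMeasurePreserving chart volume (haarAddCircle : Measure Circ) := by
  refine ⟨measurable_chart, ?_⟩
  rw [haar_eq_map_chart]
  refine Measure.AbsolutelyContinuous.map ?_ measurable_chart
  refine withDensity_absolutelyContinuous' measurable_ofReal_cauchyDensity.aemeasurable ?_
  exact Filter.Eventually.of_forall fun x => by simpa using cauchyDensity_pos x

theorem ae_chart {P : Circ → Prop} (h : ∀ᵐ θ ∂haarAddCircle, P θ) :
    ∀ᵐ x ∂μI, P (chart x) :=
  ae_restrict_of_ae (quasiMeasurePreserving_chart.ae h)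

/-- The chordal distance of two points of the circle in the chart. -/
theorem norm_fourier_one_sub_one_sq (x y : ℝ) :
    ‖(fourier 1 (chart y - chart x) - 1 : ℂ)‖ ^ 2
      = 4 * (y - x) ^ 2 / ((1 + x ^ 2) * (1 + y ^ 2)) := by
  have h1 : (fourier 1 (chart y - chart x) : ℂ)
      = Complex.exp (Complex.I * ((2 * (Real.arctan y - Real.arctan x) : ℝ) : ℂ)) := by
    have : chart y - chart x = ((Real.arctan y - Real.arctan x : ℝ) : Circ) := rfl
    rw [this, fourier_coe_apply]
    congr 1
    have : (Real.pi : ℂ) ≠ 0 := by exact_mod_cast Real.pi_ne_zero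
    push_cast
    field_simp
  rw [h1, Complex.norm_exp_I_mul_ofReal_sub_one, Real.norm_eq_abs, sq_abs,
    mul_div_cancel_left₀ _ (two_ne_zero), Real.sin_sub, Real.sin_arctan, Real.sin_arctan,
    Real.cos_arctan, Real.cos_arctan]
  have hx : √(1 + x ^ 2) ^ 2 = 1 + x ^ 2 := Real.sq_sqrt (by positivity)
  have hy : √(1 + y ^ 2) ^ 2 = 1 + y ^ 2 := Real.sq_sqrt (by positivity)
  have hx0 : √(1 + x ^ 2) ≠ 0 := by positivity
  have hy0 : √(1 + y ^ 2) ≠ 0 := by positivity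
  refine Eq.trans (b := 4 * (y - x) ^ 2 / (√(1 + x ^ 2) ^ 2 * √(1 + y ^ 2) ^ 2)) ?_ (by rw [hx, hy])
  generalize √(1 + x ^ 2) = a at *
  generalize √(1 + y ^ 2) = b at *
  field_simp
  ring

/-- The Gagliardo integrand on the line. -/
def gagliardo (u : ℝ → ℝ) (x y : ℝ) : ℝ≥0∞ := ENNReal.ofReal ((u y - u x) ^ 2 / (y - x) ^ 2)

theorem measurable_gagliardo {u : ℝ → ℝ} (hu : Measurable u) :
    Measurable (Function.uncurry (gagliardo u)) := by
  unfold gagliardo Function.uncurry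
  fun_prop

/-- Conformal invariance: in the chart the energy of the circle is the Gagliardo seminorm of the
line. -/
theorem circEnergy_eq_gagliardo {V : Circ → ℝ} (hV : Measurable V) :
    circEnergy (cx V) = ENNReal.ofReal (4 * Real.pi ^ 2)⁻¹ *
      ∫⁻ x, ∫⁻ y, gagliardo (fun x => V (chart x)) x y := by
  have hpi := Real.pi_pos
  have hcV : Measurable (cx V) := Complex.measurable_ofReal.comp hV
  have he : Continuous fun h : Circ => (fourier 1 h - 1 : ℂ) :=
    (map_continuous (fourier 1)).sub continuous_const
  have h1 : circEnergy (cx V) = ∫⁻ θ, ∫⁻ η, ‖cx V η - cx V θ‖ₑ ^ 2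
      / ‖(fourier 1 (η - θ) - 1 : ℂ)‖ₑ ^ 2 ∂haarAddCircle ∂haarAddCircle := by
    unfold circEnergy
    rw [lintegral_lintegral_swap]
    · refine lintegral_congr fun θ => ?_
      rw [← lintegral_add_left_eq_self (μ := haarAddCircle) (fun η : Circ => ‖cx V η - cx V θ‖ₑ ^ 2
        / ‖(fourier 1 (η - θ) - 1 : ℂ)‖ₑ ^ 2) θ]
      simp only [add_sub_cancel_left]
    · refine Measurable.aemeasurable ?_
      refine Measurable.div ?_ ?_
      · exact (((hcV.comp (measurable_snd.add measurable_fst)).sub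
          (hcV.comp measurable_snd)).enorm).pow_const 2
      · exact ((he.measurable.comp measurable_fst).enorm).pow_const 2
  rw [h1, lintegral_circ_eq, ← lintegral_const_mul']
  swap
  · exact ENNReal.ofReal_ne_top
  refine lintegral_congr fun x => ?_
  rw [lintegral_circ_eq, ← lintegral_const_mul' _ _ ENNReal.ofReal_ne_top,
    ← lintegral_const_mul' _ _ ENNReal.ofReal_ne_top]
  refine lintegral_congr fun y => ?_
  rcases eq_or_ne x y with rfl | hxy
  · simp [gagliardo]
  have hxy' : 0 < (y - x) ^ 2 := by
    have : y - x ≠ 0 := sub_ne_zero.2 hxy.symm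
    positivity
  have hden : 0 < 4 * (y - x) ^ 2 / ((1 + x ^ 2) * (1 + y ^ 2)) := by positivity
  have e1 : ‖cx V (chart y) - cx V (chart x)‖ₑ ^ 2
      = ENNReal.ofReal ((V (chart y) - V (chart x)) ^ 2) := by
    rw [← ofReal_norm, ← ENNReal.ofReal_pow (norm_nonneg _)]
    simp only [cx]
    rw [← Complex.ofReal_sub, Complex.norm_real, Real.norm_eq_abs, sq_abs]
  have e2 : ‖(fourier 1 (chart y - chart x) - 1 : ℂ)‖ₑ ^ 2
      = ENNReal.ofReal (4 * (y - x) ^ 2 / ((1 + x ^ 2) * (1 + y ^ 2))) := by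
    rw [← ofReal_norm, ← ENNReal.ofReal_pow (norm_nonneg _), norm_fourier_one_sub_one_sq]
  have hx := cauchyDensity_pos x
  have hy := cauchyDensity_pos y
  rw [e1, e2, ← ENNReal.ofReal_div_of_pos hden, ← ENNReal.ofReal_mul hy.le,
    ← ENNReal.ofReal_mul hx.le, gagliardo, ← ENNReal.ofReal_mul (by positivity)]
  congr 1
  unfold cauchyDensity
  have : y - x ≠ 0 := sub_ne_zero.2 hxy.symm
  field_simp

/-! ### Restriction to the interval -/

theorem enorm_sq_eq_ofReal (a : ℝ) : ‖a‖ₑ ^ 2 = ENNReal.ofReal (a ^ 2) := by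
  rw [← ofReal_norm, ← ENNReal.ofReal_pow (norm_nonneg _), Real.norm_eq_abs, sq_abs]

theorem enorm_diffQuot_sq (u : ℝ → ℝ) (p : ℝ × ℝ) :
    ‖diffQuot u p‖ₑ ^ 2 = gagliardo u p.1 p.2 := by
  rw [enorm_sq_eq_ofReal, gagliardo, diffQuot, div_pow]
  congr 2 <;> ring

theorem memLp_two_iff_lintegral {α : Type*} [MeasurableSpace α] {ν : Measure α} {g : α → ℝ}
    (hg : AEStronglyMeasurable g ν) : MemLp g 2 ν ↔ ∫⁻ x, ‖g x‖ₑ ^ 2 ∂ν ≠ ∞ := by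
  have h := eLpNorm_lt_top_iff_lintegral_rpow_enorm_lt_top (f := g) (μ := ν) (p := 2)
    (by norm_num) (by norm_num)
  simp only [ENNReal.toReal_ofNat, ENNReal.rpow_ofNat] at h
  rw [← lt_top_iff_ne_top, ← h]
  exact ⟨fun h => h.2, fun h => ⟨hg, h⟩⟩

theorem measurable_diffQuot {u : ℝ → ℝ} (hu : Measurable u) : Measurable (diffQuot u) := by
  unfold diffQuot
  fun_prop

theorem memH12_of_lintegral {u : ℝ → ℝ} (hu : Measurable u)
    (h1 : ∫⁻ x, ‖u x‖ₑ ^ 2 ∂μI ≠ ∞) (h2 : ∫⁻ x, ∫⁻ y, gagliardo u x y ∂μI ∂μI ≠ ∞) :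
    MemH12 u := by
  refine ⟨(memLp_two_iff_lintegral hu.aestronglyMeasurable).2 h1,
    (memLp_two_iff_lintegral (measurable_diffQuot hu).aestronglyMeasurable).2 ?_⟩
  simp_rw [enorm_diffQuot_sq]
  have h3 := lintegral_prod (μ := μI) (ν := μI) _ (measurable_gagliardo hu).aemeasurable
  simp only [Function.uncurry] at h3
  rwa [h3]

theorem H12.measurable (u : H12) : Measurable (u : ℝ → ℝ) :=
  (Lp.stronglyMeasurable (H12.toL2 u)).measurable

theorem H12.enorm_sq_eq (u : H12) :
    ‖u‖ₑ ^ 2 = ∫⁻ x, ‖u x‖ₑ ^ 2 ∂μI + ∫⁻ x, ∫⁻ y, gagliardo u x y ∂μI ∂μI := by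
  rw [← ofReal_norm, ← ENNReal.ofReal_pow (norm_nonneg _), H12.norm_sq_eq,
    ENNReal.ofReal_add (integral_nonneg fun _ => sq_nonneg _)
      (integral_nonneg fun _ => sq_nonneg _)]
  congr 1
  · rw [ofReal_integral_eq_lintegral_ofReal u.memH12.1.integrable_sq
      (Filter.Eventually.of_forall fun _ => sq_nonneg _)]
    simp_rw [enorm_sq_eq_ofReal]
  · change ENNReal.ofReal (∫ p, diffQuot u p ^ 2 ∂(μI.prod μI)) = _
    rw [ofReal_integral_eq_lintegral_ofReal u.memH12.2.integrable_sq
      (Filter.Eventually.of_forall fun _ => sq_nonneg _),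
      lintegral_prod _ (by
        exact ((measurable_diffQuot u.measurable).pow_const 2).ennreal_ofReal.aemeasurable)]
    refine lintegral_congr fun x => lintegral_congr fun y => ?_
    rw [gagliardo, diffQuot, div_pow]
    congr 2 <;> ring

theorem mem_span_one_iff {u : H12} :
    u ∈ Submodule.span ℝ {one} ↔ ∃ a : ℝ, ∀ᵐ x ∂μI, u x = a := by
  have h1 : (one : ℝ → ℝ) =ᵐ[μI] fun _ => 1 :=
    H12.coeFn_mk _ (memH12_of_contDiff contDiff_const)
  rw [Submodule.mem_span_singleton]
  constructor
  · rintro ⟨a, rfl⟩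
    refine ⟨a, ?_⟩
    rw [map_smul]
    filter_upwards [Lp.coeFn_smul a (H12.toL2 one), h1] with x hx hx1
    rw [hx, Pi.smul_apply, hx1]; simp
  · rintro ⟨a, ha⟩
    refine ⟨a, ?_⟩
    refine Subtype.ext (Lp.ext ?_)
    change (H12.toL2 (a • one) : ℝ → ℝ) =ᵐ[μI] u
    rw [map_smul]
    filter_upwards [Lp.coeFn_smul a (H12.toL2 one), h1, ha] with x hx hx1 hx2
    rw [hx, Pi.smul_apply, hx1, hx2]; simp

theorem sub_mem_span_one_iff {u v : H12} :
    u - v ∈ Submodule.span ℝ {one} ↔ ∃ a : ℝ, ∀ᵐ x ∂μI, u x = v x + a := by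
  rw [mem_span_one_iff]
  refine exists_congr fun a => Filter.eventually_congr ?_
  rw [map_sub]
  filter_upwards [Lp.coeFn_sub (H12.toL2 u) (H12.toL2 v)] with x hx
  rw [hx, Pi.sub_apply, sub_eq_iff_eq_add, add_comm]

theorem H12.ext_ae {u v : H12} (h : (u : ℝ → ℝ) =ᵐ[μI] v) : u = v :=
  Subtype.ext (Lp.ext h)

theorem lintegral_muI_chart_le (g : Circ → ℝ≥0∞) :
    ∫⁻ x, g (chart x) ∂μI ≤ ENNReal.ofReal (2 * Real.pi) * ∫⁻ θ, g θ ∂haarAddCircle := by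
  have hpi := Real.pi_pos
  rw [lintegral_circ_eq, ← lintegral_const_mul' _ _ ENNReal.ofReal_ne_top]
  refine (setLIntegral_mono' measurableSet_Ioo fun x hx => ?_).trans (setLIntegral_le_lintegral _ _)
  rw [← mul_assoc, ← ENNReal.ofReal_mul (by positivity)]
  refine le_mul_of_one_le_left' ?_
  rw [ENNReal.one_le_ofReal, cauchyDensity, ← div_eq_mul_inv, le_div_iff₀ (by positivity)]
  nlinarith [mul_nonneg (sub_nonneg.2 hx.1.le) (sub_nonneg.2 hx.2.le)]

theorem lintegral_gagliardo_chart_le {V : Circ → ℝ} (hV : Measurable V) :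
    ∫⁻ x, ∫⁻ y, gagliardo (fun x => V (chart x)) x y ∂μI ∂μI
      ≤ ENNReal.ofReal (4 * Real.pi ^ 2) * circEnergy (cx V) := by
  have hpi := Real.pi_pos
  rw [circEnergy_eq_gagliardo hV, ← mul_assoc, ← ENNReal.ofReal_mul (by positivity),
    mul_inv_cancel₀ (by positivity), ENNReal.ofReal_one, one_mul]
  exact (setLIntegral_le_lintegral _ _).trans
    (lintegral_mono fun x => setLIntegral_le_lintegral _ _)

/-- A function of finite energy on the circle restricts to an element of `H^{1/2}(-1,1)`. -/
theorem memH12_chart {V : Circ → ℝ} (hV : Measurable V) {c : Coef} (h : HasCoef V c) :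
    MemH12 (fun x => V (chart x)) := by
  have hE : circEnergy (cx V) ≠ ∞ := by
    have h1 : 2 * circEnergy (cx V) ≠ ∞ := by rw [h.two_mul_circEnergy]; finiteness
    intro h2
    rw [h2] at h1
    exact h1 (ENNReal.mul_top (by norm_num))
  refine memH12_of_lintegral (hV.comp measurable_chart) (ne_top_of_le_ne_top ?_
    (lintegral_muI_chart_le fun θ => ‖V θ‖ₑ ^ 2)) (ne_top_of_le_ne_top ?_
    (lintegral_gagliardo_chart_le hV))
  · exact ENNReal.mul_ne_top ENNReal.ofReal_ne_top ((memLp_two_iff_lintegral h.1.1).1 h.1)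
  · exact ENNReal.mul_ne_top ENNReal.ofReal_ne_top hE

/-- The function of mean zero on the circle with given coefficients, unique almost everywhere. -/
def synth (c : Coef) : Lp ℝ 2 (haarAddCircle : Measure Circ) := (exists_fun_hasCoef c).choose

theorem hasCoef_synth (c : Coef) : HasCoef (synth c) c := (exists_fun_hasCoef c).choose_spec.1

theorem fourierCoeff_synth_zero (c : Coef) : fourierCoeff (cx (synth c)) 0 = 0 :=
  (exists_fun_hasCoef c).choose_spec.2

theorem measurable_synth (c : Coef) : Measurable (synth c : Circ → ℝ) :=
  (Lp.stronglyMeasurable _).measurable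

theorem HasCoef.exists_ae_eq {V W : Circ → ℝ} {c : Coef} (hV : HasCoef V c) (hW : HasCoef W c) :
    ∃ a : ℝ, ∀ᵐ θ ∂haarAddCircle, V θ = W θ + a := by
  have h := hV.sub hW
  rw [sub_self] at h
  obtain ⟨a, ha⟩ := h.ae_const
  refine ⟨a, ?_⟩
  filter_upwards [ha] with θ hθ
  rw [← hθ]; simp

/-- Two functions of mean zero with the same coefficients agree. -/
theorem HasCoef.ae_eq_of_mean_zero {V W : Circ → ℝ} {c : Coef} (hV : HasCoef V c)
    (hW : HasCoef W c) (hV0 : fourierCoeff (cx V) 0 = 0) (hW0 : fourierCoeff (cx W) 0 = 0) :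
    V =ᵐ[haarAddCircle] W := by
  obtain ⟨a, ha⟩ := hV.exists_ae_eq hW
  have hc : cx V =ᵐ[haarAddCircle] cx W + (a : ℂ) • (fourier 0 : Circ → ℂ) := by
    filter_upwards [ha] with θ hθ
    simp [cx, hθ]
  have h := congrFun (fourierCoeff_congr_ae hc) 0
  rw [fourierCoeff.add (integrable_cx hW.1) ((integrable_fourier 0).smul _), Pi.add_apply,
    fourierCoeff.const_smul, fourierCoeff_fourier, hV0, hW0] at h
  have ha0 : a = 0 := by
    have : (0 : ℂ) = a := by simpa using h
    exact_mod_cast this.symm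
  filter_upwards [ha] with θ hθ
  rw [hθ, ha0, add_zero]

theorem synth_add (c d : Coef) : synth (c + d) = synth c + synth d := by
  refine Lp.ext ((hasCoef_synth _).ae_eq_of_mean_zero
    (hasCoef_congr ((hasCoef_synth c).add (hasCoef_synth d)) (Lp.coeFn_add _ _).symm)
    (fourierCoeff_synth_zero _) ?_)
  have : cx (synth c + synth d : Lp ℝ 2 (haarAddCircle : Measure Circ))
      =ᵐ[haarAddCircle] cx (synth c) + cx (synth d) := by
    filter_upwards [Lp.coeFn_add (synth c) (synth d)] with θ hθ
    simp only [cx, hθ, Pi.add_apply, Complex.ofReal_add]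
  rw [fourierCoeff_congr_ae this, fourierCoeff.add (integrable_cx (Lp.memLp _))
    (integrable_cx (Lp.memLp _)), Pi.add_apply, fourierCoeff_synth_zero, fourierCoeff_synth_zero,
    add_zero]

theorem synth_smul (a : ℝ) (c : Coef) : synth (a • c) = a • synth c := by
  refine Lp.ext ((hasCoef_synth _).ae_eq_of_mean_zero
    (hasCoef_congr ((hasCoef_synth c).smul a) (Lp.coeFn_smul _ _).symm)
    (fourierCoeff_synth_zero _) ?_)
  have : cx (a • synth c : Lp ℝ 2 (haarAddCircle : Measure Circ))
      =ᵐ[haarAddCircle] (a : ℂ) • cx (synth c) := by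
    filter_upwards [Lp.coeFn_smul a (synth c)] with θ hθ
    simp [cx, hθ]
  rw [fourierCoeff_congr_ae this, fourierCoeff.const_smul, fourierCoeff_synth_zero, smul_zero]

theorem restrictCoef_memH12 (c : Coef) : MemH12 (fun x => synth c (chart x)) :=
  memH12_chart (measurable_synth c) (hasCoef_synth c)

/-- The bounded operator that sends a sequence of coefficients to the restriction to `]-1,1[` of
the function on the circle that it represents. -/
def restrictCoef : Coef →L[ℝ] H12 :=
  LinearMap.mkContinuous
    { toFun := fun c => H12.mk (fun x => synth c (chart x)) (restrictCoef_memH12 c)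
      map_add' := fun c d => by
        refine H12.ext_ae ?_
        rw [map_add]
        filter_upwards [Lp.coeFn_add (H12.toL2 (H12.mk _ (restrictCoef_memH12 c)))
            (H12.toL2 (H12.mk _ (restrictCoef_memH12 d))),
          H12.coeFn_mk _ (restrictCoef_memH12 c), H12.coeFn_mk _ (restrictCoef_memH12 d),
          H12.coeFn_mk _ (restrictCoef_memH12 (c + d)),
          ae_chart (Lp.coeFn_add (synth c) (synth d))] with x h1 h2 h3 h4 h5
        rw [h1, h4, Pi.add_apply, h2, h3, synth_add, h5]; rfl
      map_smul' := fun a c => by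
        refine H12.ext_ae ?_
        rw [map_smul]
        filter_upwards [Lp.coeFn_smul a (H12.toL2 (H12.mk _ (restrictCoef_memH12 c))),
          H12.coeFn_mk _ (restrictCoef_memH12 c),
          H12.coeFn_mk _ (restrictCoef_memH12 (a • c)),
          ae_chart (Lp.coeFn_smul a (synth c))] with x h1 h2 h4 h5
        rw [RingHom.id_apply, h1, h4, Pi.smul_apply, h2, synth_smul, h5]; rfl }
    (Real.sqrt (2 * Real.pi + 4 * Real.pi ^ 2)) (by
      intro c
      have hpi := Real.pi_pos
      change ‖H12.mk (fun x => synth c (chart x)) (restrictCoef_memH12 c)‖ ≤ _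
      set u := H12.mk (fun x => synth c (chart x)) (restrictCoef_memH12 c) with hu
      have hae : (u : ℝ → ℝ) =ᵐ[μI] fun x => synth c (chart x) := H12.coeFn_mk _ _
      have h1 : ∫⁻ x, ‖u x‖ₑ ^ 2 ∂μI ≤ ENNReal.ofReal (2 * Real.pi) * circEnergy (cx (synth c)) := by
        calc ∫⁻ x, ‖u x‖ₑ ^ 2 ∂μI = ∫⁻ x, ‖synth c (chart x)‖ₑ ^ 2 ∂μI := by
              refine lintegral_congr_ae ?_
              filter_upwards [hae] with x hx
              rw [hx]
          _ ≤ _ := lintegral_muI_chart_le fun θ => ‖synth c θ‖ₑ ^ 2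
          _ ≤ _ := mul_le_mul_right (lintegral_sq_le_circEnergy (hasCoef_synth c).1
              (fourierCoeff_synth_zero c)) _
      have h2 : ∫⁻ x, ∫⁻ y, gagliardo u x y ∂μI ∂μI
          ≤ ENNReal.ofReal (4 * Real.pi ^ 2) * circEnergy (cx (synth c)) := by
        refine le_trans (le_of_eq ?_) (lintegral_gagliardo_chart_le (measurable_synth c))
        refine lintegral_congr_ae ?_
        filter_upwards [hae] with x hx
        refine lintegral_congr_ae ?_
        filter_upwards [hae] with y hy
        simp only [gagliardo, hx, hy]
      have h3 : circEnergy (cx (synth c)) ≤ ‖c‖ₑ ^ 2 := by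
        rw [← (hasCoef_synth c).two_mul_circEnergy, two_mul]
        exact le_self_add
      have h4 : ‖u‖ₑ ^ 2 ≤ ENNReal.ofReal (2 * Real.pi + 4 * Real.pi ^ 2) * ‖c‖ₑ ^ 2 := by
        rw [H12.enorm_sq_eq]
        refine (add_le_add h1 h2).trans ?_
        rw [← add_mul, ← ENNReal.ofReal_add (by positivity) (by positivity)]
        exact mul_le_mul_right h3 _
      rw [← ofReal_norm, ← ofReal_norm, ← ENNReal.ofReal_pow (norm_nonneg _),
        ← ENNReal.ofReal_pow (norm_nonneg _), ← ENNReal.ofReal_mul (by positivity),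
        ENNReal.ofReal_le_ofReal_iff (by positivity)] at h4
      refine (sq_le_sq₀ (norm_nonneg _) (by positivity)).1 ?_
      rwa [mul_pow, Real.sq_sqrt (by positivity)])

theorem restrictCoef_ae (c : Coef) :
    ∀ᵐ x ∂μI, restrictCoef c x = synth c (chart x) :=
  H12.coeFn_mk _ (restrictCoef_memH12 c)

/-- Modulo constants, `restrictCoef c` is the restriction of any function with coefficients `c`. -/
theorem HasCoef.restrictCoef_ae {V : Circ → ℝ} {c : Coef} (h : HasCoef V c) :
    ∃ a : ℝ, ∀ᵐ x ∂μI, restrictCoef c x = V (chart x) + a := by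
  obtain ⟨a, ha⟩ := (hasCoef_synth c).exists_ae_eq h
  refine ⟨a, ?_⟩
  filter_upwards [Contact.restrictCoef_ae c, ae_chart ha] with x hx hx'
  rw [hx, hx']

/-! ### Extension by inversion -/

/-- The inverse of the chart. At the point at infinity it takes the junk value `tan (π / 2) = 0`. -/
def unchart (θ : Circ) : ℝ := Real.tan (measurableEquivIoc Real.pi (-(Real.pi / 2)) θ : ℝ)

theorem measurable_unchart : Measurable unchart := by
  have h : Measurable Real.tan := by
    have : Real.tan = fun x => Real.sin x / Real.cos x := funext Real.tan_eq_sin_div_cos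
    rw [this]
    exact Real.measurable_sin.div Real.measurable_cos
  exact h.comp (measurable_subtype_coe.comp (measurableEquivIoc Real.pi _).measurable)

theorem unchart_chart (x : ℝ) : unchart (chart x) = x := by
  have hmem : Real.arctan x ∈ Ioc (-(Real.pi / 2)) (-(Real.pi / 2) + Real.pi) :=
    ⟨Real.neg_pi_div_two_lt_arctan x, by linarith [Real.arctan_lt_pi_div_two x]⟩
  have : ((measurableEquivIoc Real.pi (-(Real.pi / 2)) (chart x)) : ℝ) = Real.arctan x :=
    equivIoc_coe_of_mem hmem
  rw [unchart, this, Real.tan_arctan]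

/-- Folding the line onto `]-1,1[` by the inversion `x ↦ 1/x`. -/
theorem lintegral_fold (g : ℝ → ℝ≥0∞) :
    ∫⁻ x, g x = ∫⁻ x, g x ∂μI + ∫⁻ x, ENNReal.ofReal (x ^ 2)⁻¹ * g x⁻¹ ∂μI := by
  rw [← lintegral_add_compl g (measurableSet_Ioo (a := (-1 : ℝ)) (b := 1))]
  congr 1
  have himg : (fun x : ℝ => x⁻¹) '' (Ioo (-1) 1 \ {0}) = (Icc (-1 : ℝ) 1)ᶜ := by
    ext y
    simp only [mem_image, mem_sdiff, mem_Ioo, mem_singleton_iff, mem_compl_iff, mem_Icc, not_and_or,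
      not_le]
    constructor
    · rintro ⟨x, ⟨⟨h1, h2⟩, h0⟩, rfl⟩
      rcases lt_or_gt_of_ne h0 with h | h
      · left
        have h3 : 1 < (-x)⁻¹ := (one_lt_inv₀ (by linarith)).2 (by linarith)
        rw [inv_neg] at h3
        linarith
      · right
        exact (one_lt_inv₀ h).2 h2
    · rintro (h | h)
      · refine ⟨y⁻¹, ⟨⟨?_, ?_⟩, ?_⟩, inv_inv y⟩
        · rw [lt_inv_of_neg (by norm_num) (by linarith)]
          norm_num
          linarith
        · have : y⁻¹ < 0 := inv_lt_zero.2 (by linarith)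
          linarith
        · exact inv_ne_zero (by linarith)
      · refine ⟨y⁻¹, ⟨⟨?_, ?_⟩, ?_⟩, inv_inv y⟩
        · have : 0 < y⁻¹ := inv_pos.2 (by linarith)
          linarith
        · exact inv_lt_one_of_one_lt₀ h
        · exact inv_ne_zero (by linarith)
  have h1 : ((Ioo (-1 : ℝ) 1)ᶜ : Set ℝ) =ᵐ[volume] ((Icc (-1 : ℝ) 1)ᶜ : Set ℝ) :=
    Ioo_ae_eq_Icc.compl
  have h2 : (Ioo (-1 : ℝ) 1 \ {0} : Set ℝ) =ᵐ[volume] Ioo (-1 : ℝ) 1 :=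
    sdiff_null_ae_eq_self (by simp)
  rw [setLIntegral_congr h1, ← himg, lintegral_image_eq_lintegral_abs_deriv_mul
    (measurableSet_Ioo.diff (measurableSet_singleton 0))
    (fun x hx => (hasDerivAt_inv (fun h0 => hx.2 h0)).hasDerivWithinAt)
    (fun x _ y _ h => inv_injective h), setLIntegral_congr h2]
  refine lintegral_congr fun x => ?_
  rw [abs_neg, abs_of_nonneg (by positivity)]

/-- The extension of a function on `]-1,1[` to the line by inversion. -/
def inversionExt (u : ℝ → ℝ) (x : ℝ) : ℝ := if |x| < 1 then u x else u x⁻¹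

theorem measurable_inversionExt {u : ℝ → ℝ} (hu : Measurable u) : Measurable (inversionExt u) :=
  Measurable.ite (measurableSet_lt measurable_abs measurable_const) hu
    (hu.comp measurable_inv)

theorem inversionExt_of_mem {u : ℝ → ℝ} {x : ℝ} (hx : x ∈ Ioo (-1 : ℝ) 1) :
    inversionExt u x = u x := if_pos (abs_lt.2 hx)

theorem inversionExt_inv {u : ℝ → ℝ} {x : ℝ} (hx : x ∈ Ioo (-1 : ℝ) 1) :
    inversionExt u x⁻¹ = u x := by
  rcases eq_or_ne x 0 with rfl | h0
  · rw [inv_zero, inversionExt_of_mem (by norm_num)]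
  rw [inversionExt, if_neg, inv_inv]
  rw [not_lt, abs_inv, one_le_inv₀ (abs_pos.2 h0)]
  exact (abs_lt.2 hx).le

/-- `(1 - x y)² - (y - x)² = (1 - x²) (1 - y²)`. -/
theorem one_sub_mul_sq_ge {x y : ℝ} (hx : x ∈ Ioo (-1 : ℝ) 1) (hy : y ∈ Ioo (-1 : ℝ) 1) :
    (y - x) ^ 2 ≤ (1 - x * y) ^ 2 := by
  have h1 : 0 ≤ 1 - x ^ 2 := by nlinarith [hx.1, hx.2]
  have h2 : 0 ≤ 1 - y ^ 2 := by nlinarith [hy.1, hy.2]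
  nlinarith [mul_nonneg h1 h2]

/-- The mixed terms of the folded double integral. -/
theorem gagliardo_inversionExt_inv_right_le (u : ℝ → ℝ) {x y : ℝ} (hx : x ∈ Ioo (-1 : ℝ) 1)
    (hy : y ∈ Ioo (-1 : ℝ) 1) :
    ENNReal.ofReal (y ^ 2)⁻¹ * gagliardo (inversionExt u) x y⁻¹ ≤ gagliardo u x y := by
  rw [gagliardo, gagliardo, inversionExt_of_mem hx, inversionExt_inv hy,
    ← ENNReal.ofReal_mul (by positivity)]
  rcases eq_or_ne y 0 with rfl | hy0
  · simp
  rcases eq_or_ne x y with rfl | hxy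
  · simp
  refine ENNReal.ofReal_le_ofReal ?_
  have h1 : (y ^ 2)⁻¹ * ((u y - u x) ^ 2 / (y⁻¹ - x) ^ 2) = (u y - u x) ^ 2 / (1 - x * y) ^ 2 := by
    rw [show y⁻¹ - x = (1 - x * y) / y by field_simp, div_pow]
    field_simp
  have h2 : 0 < (y - x) ^ 2 := by
    have := sub_ne_zero.2 hxy.symm
    positivity
  rw [h1]
  exact div_le_div_of_nonneg_left (sq_nonneg _) h2 (one_sub_mul_sq_ge hx hy)

theorem gagliardo_comm (u : ℝ → ℝ) (x y : ℝ) : gagliardo u x y = gagliardo u y x := by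
  unfold gagliardo
  congr 2 <;> ring

/-- The inversion preserves the kernel `dx dy / (x - y)²`; the two sides are equal unless
`x y = 0`, where the left one is a junk value. -/
theorem gagliardo_inversionExt_inv_inv_le (u : ℝ → ℝ) {x y : ℝ} (hx : x ∈ Ioo (-1 : ℝ) 1)
    (hy : y ∈ Ioo (-1 : ℝ) 1) :
    ENNReal.ofReal (x ^ 2)⁻¹ * (ENNReal.ofReal (y ^ 2)⁻¹ * gagliardo (inversionExt u) x⁻¹ y⁻¹)
      ≤ gagliardo u x y := by
  rw [gagliardo, gagliardo, inversionExt_inv hx, inversionExt_inv hy,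
    ← ENNReal.ofReal_mul (by positivity), ← ENNReal.ofReal_mul (by positivity)]
  rcases eq_or_ne y 0 with rfl | hy0
  · simp
  rcases eq_or_ne x 0 with rfl | hx0
  · simp
  refine le_of_eq (congrArg _ ?_)
  rw [show y⁻¹ - x⁻¹ = -(y - x) / (x * y) by field_simp; ring, div_pow, neg_sq]
  field_simp

/-- Extension by inversion multiplies the Gagliardo seminorm by at most `2`. -/
theorem lintegral_gagliardo_inversionExt_le (u : ℝ → ℝ) (hu : Measurable u) :
    ∫⁻ x, ∫⁻ y, gagliardo (inversionExt u) x y ≤ 4 * ∫⁻ x, ∫⁻ y, gagliardo u x y ∂μI ∂μI := by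
  set k : ℝ → ℝ≥0∞ := fun x => ∫⁻ y, gagliardo u x y ∂μI with hk
  have hkm : Measurable k := (measurable_gagliardo hu).lintegral_prod_right
  have h1 : ∀ x ∈ Ioo (-1 : ℝ) 1, ∫⁻ y, gagliardo (inversionExt u) x y ≤ 2 * k x := by
    intro x hx
    rw [lintegral_fold, two_mul]
    refine add_le_add (le_of_eq ?_) ?_
    · refine setLIntegral_congr_fun measurableSet_Ioo fun y hy => ?_
      simp only [gagliardo, inversionExt_of_mem hx, inversionExt_of_mem hy]
    · exact setLIntegral_mono' measurableSet_Ioo fun y hy =>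
        gagliardo_inversionExt_inv_right_le u hx hy
  have h2 : ∀ x ∈ Ioo (-1 : ℝ) 1, ENNReal.ofReal (x ^ 2)⁻¹ *
      ∫⁻ y, gagliardo (inversionExt u) x⁻¹ y ≤ 2 * k x := by
    intro x hx
    rw [lintegral_fold, two_mul, mul_add, ← lintegral_const_mul' _ _ ENNReal.ofReal_ne_top,
      ← lintegral_const_mul' _ _ ENNReal.ofReal_ne_top]
    refine add_le_add ?_ ?_
    · refine setLIntegral_mono' measurableSet_Ioo fun y hy => ?_
      rw [gagliardo_comm, gagliardo_comm u]
      exact gagliardo_inversionExt_inv_right_le u hy hx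
    · exact setLIntegral_mono' measurableSet_Ioo fun y hy =>
        gagliardo_inversionExt_inv_inv_le u hx hy
  rw [lintegral_fold]
  calc _ ≤ ∫⁻ x, 2 * k x ∂μI + ∫⁻ x, 2 * k x ∂μI :=
        add_le_add (setLIntegral_mono' measurableSet_Ioo h1)
          (setLIntegral_mono' measurableSet_Ioo h2)
    _ = 4 * ∫⁻ x, k x ∂μI := by
        rw [lintegral_const_mul _ hkm, ← add_mul]
        norm_num

theorem lintegral_sq_inversionExt_le (u : ℝ → ℝ) (hu : Measurable u) :
    ∫⁻ x, ENNReal.ofReal (cauchyDensity x) * ‖inversionExt u x‖ₑ ^ 2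
      ≤ ∫⁻ x, ‖u x‖ₑ ^ 2 ∂μI := by
  have hpi := Real.pi_gt_three
  have hle : ∀ x, 2 * cauchyDensity x ≤ 1 := by
    intro x
    rw [cauchyDensity, ← div_eq_mul_inv, div_le_one (by positivity)]
    nlinarith [sq_nonneg x]
  rw [lintegral_fold, ← lintegral_add_left]
  swap
  · exact measurable_ofReal_cauchyDensity.mul ((measurable_inversionExt hu).enorm.pow_const 2)
  refine setLIntegral_mono' measurableSet_Ioo fun x hx => ?_
  rw [inversionExt_of_mem hx, inversionExt_inv hx, ← mul_assoc, ← add_mul,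
    ← ENNReal.ofReal_mul (by positivity), ← ENNReal.ofReal_add (cauchyDensity_pos x).le
      (mul_nonneg (by positivity) (cauchyDensity_pos _).le)]
  refine mul_le_of_le_one_left' ?_
  rw [ENNReal.ofReal_le_one]
  refine le_trans ?_ (hle x)
  rw [two_mul]
  gcongr
  rcases eq_or_ne x 0 with rfl | h0
  · simpa using (cauchyDensity_pos 0).le
  · refine le_of_eq ?_
    unfold cauchyDensity
    field_simp
    ring

/-- Every element of `H^{1/2}(-1,1)` is, modulo constants, the restriction of a function on the
circle whose coefficients are controlled by its norm. -/
theorem exists_restrictCoef_lift (w : H12) :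
    ∃ d : Coef, restrictCoef d - w ∈ Submodule.span ℝ {one} ∧ ‖d‖ ≤ 1 * ‖w‖ := by
  have hpi := Real.pi_gt_three
  set V : Circ → ℝ := fun θ => inversionExt w (unchart θ) with hVdef
  have hV : Measurable V := (measurable_inversionExt w.measurable).comp measurable_unchart
  have hVc : (fun x => V (chart x)) = inversionExt w := by
    funext x; simp only [hVdef, unchart_chart]
  have hnorm := w.enorm_sq_eq
  have hfin : ‖w‖ₑ ^ 2 ≠ ∞ := by finiteness
  have hL2 : MemLp V 2 haarAddCircle := by
    rw [memLp_two_iff_lintegral hV.aestronglyMeasurable, lintegral_circ_eq]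
    refine ne_top_of_le_ne_top hfin ?_
    rw [hnorm]
    refine le_trans ?_ le_self_add
    refine le_trans (le_of_eq ?_) (lintegral_sq_inversionExt_le w w.measurable)
    exact lintegral_congr fun x => by rw [← congrFun hVc x]
  have hE : 2 * circEnergy (cx V) ≤ ‖w‖ₑ ^ 2 := by
    rw [circEnergy_eq_gagliardo hV, hVc, hnorm, ← mul_assoc]
    calc 2 * ENNReal.ofReal (4 * Real.pi ^ 2)⁻¹ * ∫⁻ x, ∫⁻ y, gagliardo (inversionExt w) x y
        ≤ 2 * ENNReal.ofReal (4 * Real.pi ^ 2)⁻¹ *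
            (4 * ∫⁻ x, ∫⁻ y, gagliardo w x y ∂μI ∂μI) :=
          mul_le_mul_right (lintegral_gagliardo_inversionExt_le w w.measurable) _
      _ ≤ 1 * ∫⁻ x, ∫⁻ y, gagliardo w x y ∂μI ∂μI := by
          rw [← mul_assoc]
          refine mul_le_mul_left ?_ _
          rw [← ENNReal.ofReal_ofNat 2, ← ENNReal.ofReal_ofNat 4,
            ← ENNReal.ofReal_mul (by norm_num), ← ENNReal.ofReal_mul (by positivity),
            ENNReal.ofReal_le_one, mul_assoc, inv_mul_eq_div, mul_div_assoc',
            div_le_one (by positivity)]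
          nlinarith
      _ ≤ _ := by rw [one_mul]; exact le_add_self
  have hE' : circEnergy (cx V) ≠ ∞ := by
    intro h
    rw [h, ENNReal.mul_top (by norm_num)] at hE
    exact hfin (top_le_iff.1 hE)
  obtain ⟨d, hd⟩ := exists_hasCoef hL2 hE'
  refine ⟨d, ?_, ?_⟩
  · obtain ⟨a, ha⟩ := hd.restrictCoef_ae
    refine sub_mem_span_one_iff.2 ⟨a, ?_⟩
    filter_upwards [ha, ae_restrict_mem measurableSet_Ioo] with x hx hxI
    rw [hx, congrFun hVc x, inversionExt_of_mem hxI]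
  · rw [hd.two_mul_circEnergy] at hE
    rw [one_mul]
    rw [← ofReal_norm, ← ofReal_norm, ← ENNReal.ofReal_pow (norm_nonneg _),
        ← ENNReal.ofReal_pow (norm_nonneg _), ENNReal.ofReal_le_ofReal_iff (by positivity)] at hE
    exact (sq_le_sq₀ (norm_nonneg _) (norm_nonneg _)).1 hE

/-! ### Contractions and the skew form -/

open Filter Topology

/-- If `W = G ∘ V` with `G` nondecreasing and nonexpansive, the increments of `W` and of `V - W`
have the same sign, so that the energy of `V` is at least the sum of the energies of `W` and
`V - W`. -/
theorem circEnergy_sub_add_le {G : ℝ → ℝ} (hG : Monotone G) (hL : LipschitzWith 1 G)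
    (V : Circ → ℝ) :
    circEnergy (cx (V - G ∘ V)) + circEnergy (cx (G ∘ V)) ≤ circEnergy (cx V) := by
  have key : ∀ s r : ℝ, ((s - G s) - (r - G r)) ^ 2 + (G s - G r) ^ 2 ≤ (s - r) ^ 2 := by
    have : ∀ s r : ℝ, r ≤ s →
        ((s - G s) - (r - G r)) ^ 2 + (G s - G r) ^ 2 ≤ (s - r) ^ 2 := by
      intro s r h
      have h1 : 0 ≤ G s - G r := sub_nonneg.2 (hG h)
      have h2 : G s - G r ≤ s - r := by
        have := hL.dist_le_mul s r
        rw [Real.dist_eq, Real.dist_eq, abs_of_nonneg h1, abs_of_nonneg (sub_nonneg.2 h)] at this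
        simpa using this
      nlinarith [mul_nonneg h1 (sub_nonneg.2 h2)]
    intro s r
    rcases le_total r s with h | h
    · exact this s r h
    · have := this r s h
      nlinarith
  unfold circEnergy
  refine (le_lintegral_add _ _).trans (lintegral_mono fun h => ?_)
  refine (le_lintegral_add _ _).trans (lintegral_mono fun θ => ?_)
  simp only
  rw [← ENNReal.add_div]
  refine ENNReal.div_le_div_right ?_ _
  have e : ∀ s r : ℝ, ‖((s : ℂ) - (r : ℂ))‖ₑ ^ 2 = ENNReal.ofReal ((s - r) ^ 2) := by
    intro s r
    rw [← Complex.ofReal_sub, ← ofReal_norm, ← ENNReal.ofReal_pow (norm_nonneg _),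
      Complex.norm_real, Real.norm_eq_abs, sq_abs]
  simp only [cx, e]
  rw [← ENNReal.ofReal_add (by positivity) (by positivity)]
  exact ENNReal.ofReal_le_ofReal (key _ _)

/-- The Dirichlet form property: a nondecreasing contraction operates on functions of finite energy,
and `⟪V, G V⟫ ≥ ⟪G V, G V⟫` for the energy form. -/
theorem HasCoef.exists_comp {G : ℝ → ℝ} (hG : Monotone G) (hL : LipschitzWith 1 G)
    {V : Circ → ℝ} {c : Coef} (hV : HasCoef V c) :
    ∃ d : Coef, HasCoef (G ∘ V) d ∧ ‖d‖ ^ 2 ≤ ⟪c, d⟫_ℝ := by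
  have hfin : circEnergy (cx V) ≠ ∞ := by
    intro h
    have h1 := hV.two_mul_circEnergy
    rw [h, ENNReal.mul_top (by norm_num)] at h1
    exact (by finiteness : ‖c‖ₑ ^ 2 ≠ ∞) h1.symm
  have hle := circEnergy_sub_add_le hG hL V
  have hmem : MemLp (G ∘ V) 2 haarAddCircle := by
    have h0 : MemLp (fun θ => ‖V θ‖ + ‖G 0‖) 2 haarAddCircle := hV.1.norm.add (memLp_const _)
    refine h0.mono' (hL.continuous.comp_aestronglyMeasurable hV.1.1) ?_
    refine Eventually.of_forall fun θ => ?_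
    have h1 := hL.dist_le_mul (V θ) 0
    rw [Real.dist_eq, Real.dist_eq, NNReal.coe_one, one_mul, sub_zero] at h1
    have h2 := abs_sub_abs_le_abs_sub (G (V θ)) (G 0)
    simp only [Function.comp_apply, Real.norm_eq_abs]
    linarith
  obtain ⟨d, hd⟩ := exists_hasCoef hmem (ne_top_of_le_ne_top hfin (le_add_self.trans hle))
  refine ⟨d, hd, ?_⟩
  -- in coefficients `‖c - d‖² + ‖d‖² ≤ ‖c‖²`; expand the first square
  have h1 := mul_le_mul_right hle 2
  rw [mul_add, hd.two_mul_circEnergy, (hV.sub hd).two_mul_circEnergy,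
    hV.two_mul_circEnergy] at h1
  simp only [← ofReal_norm] at h1
  rw [← ENNReal.ofReal_pow (norm_nonneg _), ← ENNReal.ofReal_pow (norm_nonneg _),
    ← ENNReal.ofReal_pow (norm_nonneg _), ← ENNReal.ofReal_add (by positivity) (by positivity),
    ENNReal.ofReal_le_ofReal_iff (by positivity), norm_sub_sq_real] at h1
  linarith

theorem inner_coef_single (k : ℕ) (z : ℂ) (d : Coef) :
    ⟪(lp.single 2 k z : Coef), d⟫_ℝ = (conj z * d k).re := by
  rw [lp.inner_single_left, Complex.inner, mul_comm]

/-- The trigonometric monomial with the single coefficient `z` at `k`. -/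
def trigMono (k : ℕ) (z : ℂ) (θ : Circ) : ℝ :=
  (z / (√(k + 1 : ℝ) : ℝ) * fourier (k + 1) θ).re

/-- The derivative of the trigonometric monomial `trigMono k z`. -/
def trigMonoDeriv (k : ℕ) (z : ℂ) (θ : Circ) : ℝ :=
  (2 * Complex.I * z * (√(k + 1 : ℝ) : ℝ) * fourier (k + 1) θ).re

theorem continuous_trigMono (k : ℕ) (z : ℂ) : Continuous (trigMono k z) := by
  unfold trigMono
  exact Complex.continuous_re.comp (continuous_const.mul (map_continuous (fourier _)))

theorem continuous_trigMonoDeriv (k : ℕ) (z : ℂ) : Continuous (trigMonoDeriv k z) := by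
  unfold trigMonoDeriv
  exact Complex.continuous_re.comp (continuous_const.mul (map_continuous (fourier _)))

theorem hasDerivAt_trigMono (k : ℕ) (z : ℂ) (x : ℝ) :
    HasDerivAt (fun x : ℝ => trigMono k z (x : Circ)) (trigMonoDeriv k z (x : Circ)) x := by
  have h := ((hasDerivAt_fourier Real.pi (k + 1) x).const_mul (z / (√(k + 1 : ℝ) : ℝ)))
  have h2 := Complex.reCLM.hasFDerivAt.comp_hasDerivAt x h
  refine h2.congr_deriv ?_
  simp only [Complex.reCLM_apply, trigMonoDeriv]
  congr 1
  have hs : ((√(k + 1 : ℝ) : ℝ) : ℂ) * (√(k + 1 : ℝ) : ℝ) = (k + 1 : ℂ) := by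
    rw [← Complex.ofReal_mul, Real.mul_self_sqrt (by positivity)]
    push_cast; rfl
  have hs0 : ((√(k + 1 : ℝ) : ℝ) : ℂ) ≠ 0 := by
    rw [Complex.ofReal_ne_zero]; positivity
  have hpi : (Real.pi : ℂ) ≠ 0 := by exact_mod_cast Real.pi_ne_zero
  push_cast
  rw [← hs]
  field_simp

theorem fourierCoeff_trigMono (k : ℕ) (z : ℂ) (n : ℤ) :
    fourierCoeff (cx (trigMono k z)) n
      = (z / (√(k + 1 : ℝ) : ℝ) * (Pi.single (k + 1 : ℤ) (1 : ℂ) : ℤ → ℂ) n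
        + conj (z / (√(k + 1 : ℝ) : ℝ)) * (Pi.single (-(k + 1 : ℤ)) (1 : ℂ) : ℤ → ℂ) n) / 2 := by
  set w : ℂ := z / (√(k + 1 : ℝ) : ℝ)
  have h : cx (trigMono k z) = ((w / 2) • (fourier (k + 1 : ℤ) : Circ → ℂ))
      + ((conj w / 2) • (fourier (-(k + 1 : ℤ)) : Circ → ℂ)) := by
    funext θ
    simp only [cx, trigMono, Pi.add_apply, Pi.smul_apply, smul_eq_mul]
    rw [Complex.re_eq_add_conj, fourier_neg, map_mul]
    ring
  rw [h, fourierCoeff.add ((integrable_fourier _).smul _) ((integrable_fourier _).smul _),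
    Pi.add_apply, fourierCoeff.const_smul, fourierCoeff.const_smul, fourierCoeff_fourier,
    fourierCoeff_fourier, smul_eq_mul, smul_eq_mul]
  ring

theorem hasCoef_trigMono (k : ℕ) (z : ℂ) : HasCoef (trigMono k z) (lp.single 2 k z : Coef) := by
  refine ⟨(continuous_trigMono k z).memLp_of_hasCompactSupport
    (HasCompactSupport.of_compactSpace _), fun j => ?_⟩
  rw [fourierCoeff_trigMono, Pi.single_eq_of_ne (i := -(k + 1 : ℤ)) (by omega)]
  rcases eq_or_ne j k with rfl | hjk
  · rw [lp.single_apply_self, Pi.single_eq_same]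
    have hs0 : ((√(j + 1 : ℝ) : ℝ) : ℂ) ≠ 0 := by
      rw [Complex.ofReal_ne_zero]; positivity
    push_cast
    field_simp
    simp
  · rw [lp.single_apply_ne _ _ _ hjk, Pi.single_eq_of_ne (by omega)]
    simp

theorem fourierCoeff_trigMono_zero (k : ℕ) (z : ℂ) : fourierCoeff (cx (trigMono k z)) 0 = 0 := by
  rw [fourierCoeff_trigMono, Pi.single_eq_of_ne (by omega), Pi.single_eq_of_ne (by omega)]
  simp

/-- Integration against the derivative of a monomial, in terms of coefficients. -/
theorem inner_I_smul_single {W : Circ → ℝ} {d : Coef} (hW : HasCoef W d) (k : ℕ) (z : ℂ) :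
    ⟪(lp.single 2 k (Complex.I * z) : Coef), d⟫_ℝ
      = ∫ θ, W θ * trigMonoDeriv k z θ ∂haarAddCircle := by
  rw [inner_coef_single, hW.2 k, fourierCoeff, ← integral_const_mul, ← integral_const_mul]
  have hi : Integrable (fun θ => conj (Complex.I * z) * (((2 * √(k + 1 : ℝ) : ℝ) : ℂ) *
      (fourier (-(k + 1 : ℤ)) θ • cx W θ))) haarAddCircle :=
    (((integrable_cx hW.1).fourier_smul _).const_mul _).const_mul _
  have h1 := Complex.reCLM.integral_comp_comm hi
  simp only [Complex.reCLM_apply] at h1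
  rw [← h1]
  refine integral_congr_ae (Eventually.of_forall fun θ => ?_)
  simp only [cx, trigMonoDeriv, smul_eq_mul]
  rw [← Complex.conj_re (2 * Complex.I * z * _ * _), ← Complex.re_ofReal_mul]
  congr 1
  simp only [map_mul, Complex.conj_ofReal, fourier_neg, Complex.conj_I]
  rw [show (conj (2 : ℂ)) = 2 from Complex.conj_ofReal 2]
  push_cast
  ring

/-- The truncation of a sequence of coefficients. -/
def trunc (c : Coef) (N : ℕ) : Coef := ∑ k ∈ Finset.range N, lp.single 2 k (c k)

theorem tendsto_trunc (c : Coef) : Tendsto (trunc c) atTop (𝓝 c) :=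
  (lp.hasSum_single (by norm_num) c).tendsto_sum_nat

theorem tendsto_trunc_I (c : Coef) : Tendsto
    (fun N => ∑ k ∈ Finset.range N, (lp.single 2 k (Complex.I * c k) : Coef)) atTop
    (𝓝 (Complex.I • c)) :=
  (lp.hasSum_single (by norm_num) (Complex.I • c)).tendsto_sum_nat

/-- The trigonometric polynomial whose coefficients are those of `c` up to order `N`. -/
def trigPoly (c : Coef) (N : ℕ) : Circ → ℝ := ∑ k ∈ Finset.range N, trigMono k (c k)

theorem hasCoef_trigPoly (c : Coef) (N : ℕ) : HasCoef (trigPoly c N) (trunc c N) := by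
  unfold trigPoly trunc
  induction N with
  | zero => exact hasCoef_const 0
  | succ N ih =>
    rw [Finset.sum_range_succ, Finset.sum_range_succ]
    exact ih.add (hasCoef_trigMono _ _)

theorem fourierCoeff_trigPoly_zero (c : Coef) (N : ℕ) :
    fourierCoeff (cx (trigPoly c N)) 0 = 0 := by
  induction N with
  | zero => simp [trigPoly, fourierCoeff, cx]
  | succ N ih =>
    have h : cx (trigPoly c (N + 1)) = cx (trigPoly c N) + cx (trigMono N (c N)) := by
      funext θ
      simp [cx, trigPoly, Finset.sum_range_succ]
    rw [h, fourierCoeff.add (integrable_cx (hasCoef_trigPoly c N).1)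
      (integrable_cx (hasCoef_trigMono _ _).1), Pi.add_apply, ih, fourierCoeff_trigMono_zero,
      add_zero]

/-- For a trigonometric polynomial `P` and continuous `G`, the integral of `G(P) P'` over the circle
vanishes, by periodicity. -/
theorem integral_comp_trigPoly_mul_deriv {G : ℝ → ℝ} (hG : Continuous G) (c : Coef) (N : ℕ) :
    ∫ θ, G (trigPoly c N θ) * ∑ k ∈ Finset.range N, trigMonoDeriv k (c k) θ ∂haarAddCircle
      = 0 := by
  rw [integral_haarAddCircle, ← AddCircle.intervalIntegral_preimage Real.pi 0 (fun θ : Circ =>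
    G (trigPoly c N θ) * ∑ k ∈ Finset.range N, trigMonoDeriv k (c k) θ)]
  have hd : ∀ x : ℝ, HasDerivAt (fun x : ℝ => trigPoly c N (x : Circ))
      (∑ k ∈ Finset.range N, trigMonoDeriv k (c k) (x : Circ)) x := by
    intro x
    have := HasDerivAt.fun_sum (u := Finset.range N)
      (A := fun k (x : ℝ) => trigMono k (c k) (x : Circ)) fun k _ => hasDerivAt_trigMono k (c k) x
    simpa only [trigPoly, Finset.sum_apply] using this
  have hc : Continuous fun x : ℝ => ∑ k ∈ Finset.range N, trigMonoDeriv k (c k) (x : Circ) :=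
    continuous_finsetSum _ fun k _ =>
      (continuous_trigMonoDeriv k (c k)).comp (AddCircle.continuous_mk' _)
  have h := intervalIntegral.integral_comp_mul_deriv (a := 0) (b := 0 + Real.pi) (g := G)
    (fun x _ => hd x) hc.continuousOn hG
  simp only [Function.comp_apply] at h
  rw [h, zero_add, AddCircle.coe_period]
  simp

theorem inner_trunc_I_comp {G : ℝ → ℝ} (hG : Continuous G) (c : Coef) (N : ℕ) {d : Coef}
    (hd : HasCoef (G ∘ trigPoly c N) d) :
    ⟪∑ k ∈ Finset.range N, (lp.single 2 k (Complex.I * c k) : Coef), d⟫_ℝ = 0 := by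
  rw [sum_inner, ← integral_comp_trigPoly_mul_deriv hG c N]
  simp_rw [inner_I_smul_single hd, Finset.mul_sum]
  rw [integral_finsetSum]
  · rfl
  · intro k _
    have hcont : Continuous fun θ => (G ∘ trigPoly c N) θ * trigMonoDeriv k (c k) θ := by
      refine Continuous.mul (hG.comp ?_) (continuous_trigMonoDeriv _ _)
      unfold trigPoly
      exact (continuous_finsetSum _ fun k _ => continuous_trigMono k (c k)).congr fun θ =>
        (Finset.sum_apply _ _ _).symm
    exact hcont.integrable_of_hasCompactSupport (HasCompactSupport.of_compactSpace _)

/-- Each coefficient is controlled by the `L²` norm. -/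
theorem HasCoef.enorm_apply_sq_le {U : Circ → ℝ} {e : Coef} (h : HasCoef U e) (k : ℕ) :
    ‖e k‖ₑ ^ 2 ≤ ‖(((2 * √(k + 1 : ℝ) : ℝ) : ℂ))‖ₑ ^ 2 * ∫⁻ θ, ‖U θ‖ₑ ^ 2 ∂haarAddCircle := by
  rw [h.2 k, enorm_mul, mul_pow]
  refine mul_le_mul_right ?_ _
  have h1 := lintegral_sq_eq_tsum_fourierCoeff (memLp_cx h.1)
  have h2 : ∀ θ, ‖cx U θ‖ₑ = ‖U θ‖ₑ := fun θ => by
    rw [← ofReal_norm, ← ofReal_norm, Complex.norm_real]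
  simp_rw [h2] at h1
  rw [h1]
  exact ENNReal.le_tsum ((k : ℤ) + 1)

/-- The `k`-th coefficients of `G(V)` and `G(W)` differ by at most a constant times the norm of
the difference of the coefficients of `V` and `W`, if both have mean zero. -/
theorem HasCoef.norm_comp_sub_apply_le {G : ℝ → ℝ} (hL : LipschitzWith 1 G) {V W : Circ → ℝ}
    {c b d e : Coef} (hV : HasCoef V c) (hW : HasCoef W b) (hV0 : fourierCoeff (cx V) 0 = 0)
    (hW0 : fourierCoeff (cx W) 0 = 0) (hd : HasCoef (G ∘ V) d) (he : HasCoef (G ∘ W) e) (k : ℕ) :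
    ‖d k - e k‖ ≤ 2 * √(k + 1 : ℝ) * ‖c - b‖ := by
  have h1 := (hd.sub he).enorm_apply_sq_le k
  have h2 : ∫⁻ θ, ‖(G ∘ V - G ∘ W) θ‖ₑ ^ 2 ∂haarAddCircle
      ≤ ∫⁻ θ, ‖(V - W) θ‖ₑ ^ 2 ∂haarAddCircle := by
    refine lintegral_mono fun θ => ?_
    simp only [Pi.sub_apply, Function.comp_apply]
    gcongr
    have := hL.dist_le_mul (V θ) (W θ)
    rw [NNReal.coe_one, one_mul, dist_eq_norm, dist_eq_norm] at this
    exact enorm_le_iff_norm_le.2 this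
  have h0 : fourierCoeff (cx (V - W)) 0 = 0 := by
    have : cx (V - W) = fun θ => cx V θ - cx W θ := by funext θ; simp [cx]
    rw [this, fourierCoeff_sub (integrable_cx hV.1) (integrable_cx hW.1), hV0, hW0, sub_zero]
  have h3 : ∫⁻ θ, ‖(V - W) θ‖ₑ ^ 2 ∂haarAddCircle ≤ ‖c - b‖ₑ ^ 2 := by
    refine (lintegral_sq_le_circEnergy (hV.sub hW).1 h0).trans ?_
    rw [← (hV.sub hW).two_mul_circEnergy, two_mul]
    exact le_self_add
  have h4 := h1.trans (mul_le_mul_right (h2.trans h3) _)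
  rw [← mul_pow, ← ofReal_norm, ← ofReal_norm, ← ofReal_norm, ← ENNReal.ofReal_mul (norm_nonneg _),
    ← ENNReal.ofReal_pow (norm_nonneg _), ← ENNReal.ofReal_pow (by positivity),
    ENNReal.ofReal_le_ofReal_iff (by positivity), sq_le_sq₀ (norm_nonneg _) (by positivity),
    Complex.norm_real, Real.norm_of_nonneg (by positivity)] at h4
  exact h4

/-- The skew form `(V, W) ↦ ∫ V' W` vanishes on the pairs `(V, G(V))`: this is the chain rule for
trigonometric polynomials, and passes to the limit because the coefficients of `G(Vₙ)` stay bounded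
and converge one by one. -/
theorem inner_I_smul_comp {G : ℝ → ℝ} (hG : Monotone G) (hL : LipschitzWith 1 G)
    {V : Circ → ℝ} {c d : Coef} (hV : HasCoef V c) (hV0 : fourierCoeff (cx V) 0 = 0)
    (hd : HasCoef (G ∘ V) d) : ⟪Complex.I • c, d⟫_ℝ = 0 := by
  choose e he hec using fun N => (hasCoef_trigPoly c N).exists_comp hG hL
  set J : ℕ → Coef := fun N => ∑ k ∈ Finset.range N, (lp.single 2 k (Complex.I * c k) : Coef)
  have hJ : Tendsto J atTop (𝓝 (Complex.I • c)) := tendsto_trunc_I c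
  have hen : ∀ N, ‖e N‖ ≤ ‖trunc c N‖ := by
    intro N
    have h1 := (hec N).trans (real_inner_le_norm _ _)
    rcases eq_or_lt_of_le (norm_nonneg (e N)) with h0 | h0
    · rw [← h0]; exact norm_nonneg _
    · rw [sq] at h1
      exact le_of_mul_le_mul_right h1 h0
  have hcoord : ∀ k, Tendsto (fun N => e N k) atTop (𝓝 (d k)) := by
    intro k
    rw [tendsto_iff_norm_sub_tendsto_zero]
    have h1 : Tendsto (fun N => 2 * √(k + 1 : ℝ) * ‖trunc c N - c‖) atTop (𝓝 0) := by
      have := (tendsto_iff_norm_sub_tendsto_zero.1 (tendsto_trunc c)).const_mul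
        (2 * √(k + 1 : ℝ))
      rwa [mul_zero] at this
    exact squeeze_zero (fun _ => norm_nonneg _) (fun N =>
      (hasCoef_trigPoly c N).norm_comp_sub_apply_le hL hV (fourierCoeff_trigPoly_zero c N) hV0
        (he N) hd k) h1
  have hM : ∀ M, |⟪J M, d⟫_ℝ| ≤ ‖J M - Complex.I • c‖ * ‖c‖ := by
    intro M
    have h1 : Tendsto (fun N => |⟪J M, e N⟫_ℝ|) atTop (𝓝 |⟪J M, d⟫_ℝ|) := by
      refine Tendsto.abs ?_
      simp only [J, sum_inner, inner_coef_single]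
      refine tendsto_finsetSum _ fun k _ => ?_
      exact (Complex.continuous_re.tendsto _).comp ((hcoord k).const_mul _)
    have h2 : Tendsto (fun N => ‖J M - J N‖ * ‖trunc c N‖) atTop
        (𝓝 (‖J M - Complex.I • c‖ * ‖c‖)) :=
      ((tendsto_const_nhds.sub hJ).norm).mul (tendsto_trunc c).norm
    refine le_of_tendsto_of_tendsto' h1 h2 fun N => ?_
    have h3 : ⟪J M, e N⟫_ℝ = ⟪J M - J N, e N⟫_ℝ := by
      rw [inner_sub_left, inner_trunc_I_comp hL.continuous c N (he N), sub_zero]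
    rw [h3]
    exact (abs_real_inner_le_norm _ _).trans (mul_le_mul_of_nonneg_left (hen N) (norm_nonneg _))
  have h1 : Tendsto (fun M => |⟪J M, d⟫_ℝ|) atTop (𝓝 |⟪Complex.I • c, d⟫_ℝ|) :=
    (hJ.inner tendsto_const_nhds).abs
  have h2 : Tendsto (fun M => ‖J M - Complex.I • c‖ * ‖c‖) atTop (𝓝 0) := by
    have := (tendsto_iff_norm_sub_tendsto_zero.1 hJ).mul_const ‖c‖
    rwa [zero_mul] at this
  exact abs_eq_zero.1 (le_antisymm (le_of_tendsto_of_tendsto' h1 h2 hM) (abs_nonneg _))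

/-! ### Test functions on the circle -/

theorem integral_circ_eq {E : Type*} [NormedAddCommGroup E] [NormedSpace ℝ E] {g : Circ → E}
    (hg : AEStronglyMeasurable g haarAddCircle) :
    ∫ θ, g θ ∂haarAddCircle = ∫ x, cauchyDensity x • g (chart x) := by
  have h := haar_eq_map_chart
  rw [h] at hg
  rw [h, integral_map measurable_chart.aemeasurable hg,
    integral_withDensity_eq_integral_toReal_smul measurable_ofReal_cauchyDensity
      (Eventually.of_forall fun _ => ENNReal.ofReal_lt_top)]
  refine integral_congr_ae (Eventually.of_forall fun x => ?_)
  simp only [ENNReal.toReal_ofReal (cauchyDensity_pos x).le]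

/-- A test function as a function on the circle. -/
def testCirc (φ : TestI) (θ : Circ) : ℝ := φ (unchart θ)

/-- The derivative of `testCirc φ` with respect to the angle. -/
def testCircDeriv (φ : TestI) (θ : Circ) : ℝ := (1 + unchart θ ^ 2) * deriv φ (unchart θ)

theorem testCirc_chart (φ : TestI) (x : ℝ) : testCirc φ (chart x) = φ x := by
  rw [testCirc, unchart_chart]

theorem testCircDeriv_chart (φ : TestI) (x : ℝ) :
    testCircDeriv φ (chart x) = (1 + x ^ 2) * deriv φ x := by
  rw [testCircDeriv, unchart_chart]

theorem TestI.contDiff_one (φ : TestI) : ContDiff ℝ 1 φ := φ.contDiff.of_le (by simp)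

theorem TestI.continuous_deriv (φ : TestI) : Continuous (deriv φ) :=
  (TestI.contDiff_one φ).continuous_deriv le_rfl

theorem TestI.hasDerivAt (φ : TestI) (x : ℝ) : HasDerivAt φ (deriv φ x) x :=
  ((TestI.contDiff_one φ).differentiable one_ne_zero x).hasDerivAt

theorem measurable_testCirc (φ : TestI) : Measurable (testCirc φ) :=
  φ.continuous.measurable.comp measurable_unchart

theorem measurable_testCircDeriv (φ : TestI) : Measurable (testCircDeriv φ) := by
  have : Continuous fun x : ℝ => (1 + x ^ 2) * deriv φ x :=
    (by fun_prop : Continuous fun x : ℝ => 1 + x ^ 2).mul (TestI.continuous_deriv φ)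
  exact this.measurable.comp measurable_unchart

theorem exists_bound_testCirc (φ : TestI) : ∃ C : ℝ, ∀ θ, ‖testCirc φ θ‖ ≤ C := by
  obtain ⟨C, hC⟩ := φ.hasCompactSupport.exists_bound_of_continuous φ.continuous
  exact ⟨C, fun θ => hC _⟩

theorem exists_bound_testCircDeriv (φ : TestI) : ∃ C : ℝ, ∀ θ, ‖testCircDeriv φ θ‖ ≤ C := by
  have h1 : Continuous fun x : ℝ => (1 + x ^ 2) * deriv φ x :=
    (by fun_prop : Continuous fun x : ℝ => 1 + x ^ 2).mul (TestI.continuous_deriv φ)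
  have h2 : HasCompactSupport fun x : ℝ => (1 + x ^ 2) * deriv φ x :=
    φ.hasCompactSupport.deriv.mul_left
  obtain ⟨C, hC⟩ := h2.exists_bound_of_continuous h1
  exact ⟨C, fun θ => hC _⟩

theorem memLp_testCirc (φ : TestI) : MemLp (testCirc φ) 2 haarAddCircle := by
  obtain ⟨C, hC⟩ := exists_bound_testCirc φ
  exact MemLp.of_bound (measurable_testCirc φ).aestronglyMeasurable C (Eventually.of_forall hC)

theorem memLp_testCircDeriv (φ : TestI) : MemLp (testCircDeriv φ) 2 haarAddCircle := by
  obtain ⟨C, hC⟩ := exists_bound_testCircDeriv φ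
  exact MemLp.of_bound (measurable_testCircDeriv φ).aestronglyMeasurable C (Eventually.of_forall hC)

theorem fourier_chart (n : ℤ) (x : ℝ) :
    (fourier n (chart x) : ℂ) = fourier n ((Real.arctan x : ℝ) : Circ) := rfl

theorem hasDerivAt_fourier_chart (n : ℤ) (x : ℝ) :
    HasDerivAt (fun x : ℝ => (fourier n (chart x) : ℂ))
      (2 * Complex.I * n * fourier n (chart x) * ((1 + x ^ 2 : ℝ) : ℂ)⁻¹) x := by
  have h := (hasDerivAt_fourier Real.pi n (Real.arctan x)).scomp x (Real.hasDerivAt_arctan x)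
  refine h.congr_deriv ?_
  have hpi : (Real.pi : ℂ) ≠ 0 := by exact_mod_cast Real.pi_ne_zero
  rw [fourier_chart, Complex.real_smul]
  push_cast
  field_simp

theorem continuous_fourier_chart (n : ℤ) : Continuous fun x : ℝ => (fourier n (chart x) : ℂ) :=
  continuous_iff_continuousAt.2 fun x => (hasDerivAt_fourier_chart n x).continuousAt

/-- Integration by parts for a test function, in the chart. -/
theorem fourierCoeff_testCircDeriv (φ : TestI) (n : ℤ) :
    fourierCoeff (cx (testCircDeriv φ)) n
      = 2 * Complex.I * n * fourierCoeff (cx (testCirc φ)) n := by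
  unfold fourierCoeff
  have hm1 : AEStronglyMeasurable (fun θ : Circ => fourier (-n) θ • cx (testCircDeriv φ) θ)
      haarAddCircle :=
    ((integrable_cx (memLp_testCircDeriv φ)).fourier_smul _).1
  have hm2 : AEStronglyMeasurable (fun θ : Circ => fourier (-n) θ • cx (testCirc φ) θ)
      haarAddCircle :=
    ((integrable_cx (memLp_testCirc φ)).fourier_smul _).1
  have hpi := Real.pi_pos
  rw [integral_circ_eq hm1, integral_circ_eq hm2, ← integral_const_mul]
  set E : ℝ → ℂ := fun x => fourier (-n) (chart x) with hE
  set E' : ℝ → ℂ := fun x => 2 * Complex.I * ((-n : ℤ) : ℂ) * fourier (-n) (chart x)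
    * ((1 + x ^ 2 : ℝ) : ℂ)⁻¹ with hE'
  have hEc : Continuous E := continuous_fourier_chart (-n)
  have hE'c : Continuous E' := by
    refine (continuous_const.mul hEc).mul (Continuous.inv₀ (by fun_prop) fun x => ?_)
    rw [Complex.ofReal_ne_zero]; positivity
  have hφd : ∀ x, HasDerivAt (fun x => (φ x : ℂ)) ((deriv φ x : ℝ) : ℂ) x := fun x =>
    (TestI.hasDerivAt φ x).ofReal_comp
  have hφc : Continuous fun x => (φ x : ℂ) := Complex.continuous_ofReal.comp φ.continuous
  have hφ'c : Continuous fun x => ((deriv φ x : ℝ) : ℂ) :=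
    Complex.continuous_ofReal.comp (TestI.continuous_deriv φ)
  have hs : HasCompactSupport fun x => (φ x : ℂ) :=
    φ.hasCompactSupport.comp_left Complex.ofReal_zero
  have hs' : HasCompactSupport fun x => ((deriv φ x : ℝ) : ℂ) :=
    φ.hasCompactSupport.deriv.comp_left Complex.ofReal_zero
  have hibp := integral_mul_deriv_eq_deriv_mul_of_integrable (u := E) (u' := E')
    (v := fun x => (φ x : ℂ)) (v' := fun x => ((deriv φ x : ℝ) : ℂ))
    (fun x _ => hasDerivAt_fourier_chart (-n) x) (fun x _ => hφd x)
    ((hEc.mul hφ'c).integrable_of_hasCompactSupport hs'.mul_left)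
    ((hE'c.mul hφc).integrable_of_hasCompactSupport hs.mul_left)
    ((hEc.mul hφc).integrable_of_hasCompactSupport hs.mul_left)
  have hpi0 : (Real.pi : ℂ) ≠ 0 := by exact_mod_cast Real.pi_ne_zero
  have h1 : ∫ x, cauchyDensity x • (fourier (-n) (chart x) • cx (testCircDeriv φ) (chart x))
      = (Real.pi : ℂ)⁻¹ * ∫ x, E x * ((deriv φ x : ℝ) : ℂ) := by
    rw [← integral_const_mul]
    refine integral_congr_ae (Eventually.of_forall fun x => ?_)
    have hx : ((1 : ℂ) + (x : ℂ) ^ 2) ≠ 0 := by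
      have : (1 + x ^ 2 : ℝ) ≠ 0 := by positivity
      exact_mod_cast this
    simp only [hE, cx, testCircDeriv_chart, cauchyDensity, Complex.real_smul, smul_eq_mul]
    push_cast
    field_simp
  rw [h1, hibp, ← integral_neg, ← integral_const_mul]
  refine integral_congr_ae (Eventually.of_forall fun x => ?_)
  have hx : ((1 : ℂ) + (x : ℂ) ^ 2) ≠ 0 := by
    have : (1 + x ^ 2 : ℝ) ≠ 0 := by positivity
    exact_mod_cast this
  simp only [hE', cx, testCirc_chart, cauchyDensity, Complex.real_smul, smul_eq_mul]
  push_cast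
  field_simp

/-- Test functions have finite energy, since `|n| ≤ |2 i n|²` for integers `n`. -/
theorem exists_hasCoef_testCirc (φ : TestI) : ∃ d : Coef, HasCoef (testCirc φ) d := by
  refine exists_hasCoef (memLp_testCirc φ) ?_
  have hD := memLp_cx (memLp_testCircDeriv φ)
  have h1 := lintegral_sq_eq_tsum_fourierCoeff hD
  have h2 : ∫⁻ θ, ‖cx (testCircDeriv φ) θ‖ₑ ^ 2 ∂haarAddCircle ≠ ∞ := by
    have := (memLp_two_iff_lintegral (memLp_testCircDeriv φ).1).1 (memLp_testCircDeriv φ)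
    convert this using 4
    rw [← ofReal_norm, ← ofReal_norm, Complex.norm_real]
  refine ne_top_of_le_ne_top h2 ?_
  rw [h1, circEnergy_eq_tsum (memLp_cx (memLp_testCirc φ))]
  refine ENNReal.tsum_le_tsum fun n => ?_
  rw [fourierCoeff_testCircDeriv, enorm_mul, mul_pow]
  refine mul_le_mul_left ?_ _
  rw [← ofReal_norm, ← ENNReal.ofReal_pow (norm_nonneg _)]
  rw [← ENNReal.ofReal_natCast]
  refine ENNReal.ofReal_le_ofReal ?_
  simp only [norm_mul, Complex.norm_ofNat, Complex.norm_I, mul_one, Complex.norm_intCast]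
  rw [← Int.cast_abs, Int.abs_eq_natAbs, Int.cast_natCast]
  have : (n.natAbs : ℝ) ≤ (n.natAbs : ℝ) ^ 2 := by
    exact_mod_cast Nat.le_self_pow two_ne_zero _
  nlinarith

/-- The coefficients of a test function. -/
def testCoef (φ : TestI) : Coef := (exists_hasCoef_testCirc φ).choose

theorem hasCoef_testCoef (φ : TestI) : HasCoef (testCirc φ) (testCoef φ) :=
  (exists_hasCoef_testCirc φ).choose_spec

theorem restrictCoef_testCoef_sub_mem (φ : TestI) (h : ContDiff ℝ 1 φ) :
    restrictCoef (testCoef φ) - restr φ h ∈ Submodule.span ℝ {one} := by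
  obtain ⟨a, ha⟩ := (hasCoef_testCoef φ).restrictCoef_ae
  refine sub_mem_span_one_iff.2 ⟨a, ?_⟩
  filter_upwards [ha, H12.coeFn_mk _ (memH12_of_contDiff h)] with x hx hx'
  rw [hx, testCirc_chart]
  rw [restr, hx']

/-- Parseval's identity for real functions. -/
theorem integral_mul_eq_tsum {V W : Circ → ℝ} (hV : MemLp V 2 haarAddCircle)
    (hW : MemLp W 2 haarAddCircle) :
    HasSum (fun n : ℤ => conj (fourierCoeff (cx V) n) * fourierCoeff (cx W) n)
      ((∫ θ, V θ * W θ ∂haarAddCircle : ℝ) : ℂ) := by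
  set v := (memLp_cx hV).toLp
  set w := (memLp_cx hW).toLp
  have h := (fourierBasis (T := Real.pi)).hasSum_inner_mul_inner v w
  have hv : ∀ n, ⟪fourierBasis n, v⟫_ℂ = fourierCoeff (cx V) n := fun n => by
    rw [← HilbertBasis.repr_apply_apply, fourierBasis_repr,
      fourierCoeff_congr_ae (memLp_cx hV).coeFn_toLp]
  have hw : ∀ n, ⟪fourierBasis n, w⟫_ℂ = fourierCoeff (cx W) n := fun n => by
    rw [← HilbertBasis.repr_apply_apply, fourierBasis_repr,
      fourierCoeff_congr_ae (memLp_cx hW).coeFn_toLp]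
  have hvw : ⟪v, w⟫_ℂ = ((∫ θ, V θ * W θ ∂haarAddCircle : ℝ) : ℂ) := by
    rw [L2.inner_def, ← integral_complex_ofReal]
    refine integral_congr_ae ?_
    filter_upwards [(memLp_cx hV).coeFn_toLp, (memLp_cx hW).coeFn_toLp] with θ h1 h2
    rw [h1, h2]
    simp [cx, mul_comm]
  rw [hvw] at h
  have hn : ∀ n, ⟪v, fourierBasis n⟫_ℂ * ⟪fourierBasis n, w⟫_ℂ
      = conj (fourierCoeff (cx V) n) * fourierCoeff (cx W) n := fun n => by
    rw [hw, ← hv n, inner_conj_symm]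
  simp_rw [hn] at h
  exact h

/-- The terms `±(k + 1)` of Parseval's identity add up to one term of the inner product of the
coefficients. -/
theorem HasCoef.parseval_term {V : Circ → ℝ} {c : Coef} (hV : HasCoef V c) (φ : TestI) (k : ℕ) :
    conj (fourierCoeff (cx V) (k + 1)) * fourierCoeff (cx (testCircDeriv φ)) (k + 1)
      + conj (fourierCoeff (cx V) (-(k + 1))) * fourierCoeff (cx (testCircDeriv φ)) (-(k + 1))
      = ((⟪c k, (Complex.I • testCoef φ : Coef) k⟫_ℝ : ℝ) : ℂ) := by
  rw [fourierCoeff_cx_neg, fourierCoeff_cx_neg, Complex.inner, Complex.re_eq_add_conj]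
  rw [hV.2 k, lp.coeFn_smul, Pi.smul_apply, (hasCoef_testCoef φ).2 k,
    fourierCoeff_testCircDeriv]
  have hs : ((√(k + 1 : ℝ) : ℝ) : ℂ) * (√(k + 1 : ℝ) : ℝ) = (k + 1 : ℂ) := by
    rw [← Complex.ofReal_mul, Real.mul_self_sqrt (by positivity)]
    push_cast; rfl
  simp only [smul_eq_mul, map_mul, Complex.conj_ofReal, Complex.conj_I, Complex.conj_conj]
  rw [show (conj (2 : ℂ)) = 2 from Complex.conj_ofReal 2]
  push_cast
  simp only [map_add, map_one, Complex.conj_natCast]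
  rw [← hs]
  ring

theorem tsum_int_eq_of_hasSum {a : ℤ → ℂ} {z : ℂ} (h : HasSum a z) (h0 : a 0 = 0) :
    z = ∑' k : ℕ, (a (k + 1) + a (-(k + 1))) := by
  have hp : Summable fun k : ℕ => a (k + 1) :=
    h.summable.comp_injective (i := fun k : ℕ => (k : ℤ) + 1) fun i j h => by
      simp only at h; omega
  have hn : Summable fun k : ℕ => a (-(k + 1)) :=
    h.summable.comp_injective (i := fun k : ℕ => -((k : ℤ) + 1)) fun i j h => by
      simp only at h; omega
  rw [hp.tsum_add hn, ← h.tsum_eq, tsum_of_add_one_of_neg_add_one hp hn, h0, add_zero]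

/-- The skew form `∫ V Φ'` in terms of coefficients. -/
theorem HasCoef.integral_mul_testCircDeriv {V : Circ → ℝ} {c : Coef} (hV : HasCoef V c)
    (φ : TestI) :
    ∫ θ, V θ * testCircDeriv φ θ ∂haarAddCircle = ⟪c, Complex.I • testCoef φ⟫_ℝ := by
  have h0 : conj (fourierCoeff (cx V) 0) * fourierCoeff (cx (testCircDeriv φ)) 0 = 0 := by
    rw [fourierCoeff_testCircDeriv]; simp
  have ht := tsum_int_eq_of_hasSum (integral_mul_eq_tsum hV.1 (memLp_testCircDeriv φ)) h0
  apply Complex.ofReal_injective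
  rw [ht, lp.inner_eq_tsum (𝕜 := ℝ), Complex.ofReal_tsum]
  exact tsum_congr fun k => hV.parseval_term φ k

theorem HasCoef.integral_mul_deriv {V : Circ → ℝ} {c : Coef} (hV : HasCoef V c)
    (φ : TestI) :
    ∫ x in Ioo (-1 : ℝ) 1, V (chart x) * deriv φ x
      = Real.pi * ⟪c, Complex.I • testCoef φ⟫_ℝ := by
  have hpi := Real.pi_pos
  have hm : AEStronglyMeasurable (fun θ => V θ * testCircDeriv φ θ) haarAddCircle :=
    hV.1.1.mul (measurable_testCircDeriv φ).aestronglyMeasurable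
  rw [← hV.integral_mul_testCircDeriv, integral_circ_eq hm, ← integral_const_mul,
    setIntegral_eq_integral_of_forall_compl_eq_zero]
  · refine integral_congr_ae (Eventually.of_forall fun x => ?_)
    simp only [testCircDeriv_chart, cauchyDensity, smul_eq_mul]
    field_simp
  · intro x hx
    have : x ∉ tsupport φ := fun h => hx (φ.tsupport_subset h)
    have h0 : deriv φ x = 0 := by
      by_contra hne
      exact this (support_deriv_subset hne)
    rw [h0, mul_zero]

/-! ### Fourier coefficients of the logarithmic kernel -/

/-- The logarithmic kernel of the circle, `log |e₁ - 1| = log |2 sin θ|`. -/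
def logKernel (h : Circ) : ℝ := Real.log ‖(fourier 1 h - 1 : ℂ)‖

theorem measurable_logKernel : Measurable logKernel :=
  Real.measurable_log.comp (((map_continuous (fourier 1)).sub continuous_const).norm.measurable)

theorem fourier_coe_circ (n : ℤ) (x : ℝ) :
    (fourier n (x : Circ) : ℂ) = Complex.exp (2 * n * x * Complex.I) := by
  rw [fourier_coe_apply]
  congr 1
  have hpi : (Real.pi : ℂ) ≠ 0 := by exact_mod_cast Real.pi_ne_zero
  field_simp

theorem logKernel_coe (x : ℝ) : logKernel (x : Circ) = Real.log (2 * Real.sin x) := by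
  rw [logKernel, fourier_coe_circ, show (2 * ((1 : ℤ) : ℂ) * (x : ℂ) * Complex.I)
    = Complex.I * ((2 * x : ℝ) : ℂ) by push_cast; ring, Complex.norm_exp_I_mul_ofReal_sub_one,
    mul_div_cancel_left₀ _ two_ne_zero, Real.norm_eq_abs, Real.log_abs]

theorem intervalIntegrable_log_two_mul_sin (a b : ℝ) :
    IntervalIntegrable (fun x => Real.log (2 * Real.sin x)) volume a b := by
  have h : IntervalIntegrable (fun x => Real.log 2 + Real.log (Real.sin x)) volume a b :=
    intervalIntegrable_const.add intervalIntegrable_log_sin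
  refine h.congr_ae ?_
  have h0 : ∀ᵐ x : ℝ, Real.sin x ≠ 0 := by
    have hc : {x : ℝ | Real.sin x = 0}.Countable := by
      have : {x : ℝ | Real.sin x = 0} = range fun n : ℤ => (n : ℝ) * Real.pi := by
        ext x; simp [Real.sin_eq_zero_iff]
      rw [this]; exact countable_range _
    exact hc.ae_notMem volume
  filter_upwards [ae_restrict_of_ae h0] with x hx
  rw [Real.log_mul two_ne_zero hx]

theorem integrable_logKernel : Integrable logKernel haarAddCircle := by
  have h := (intervalIntegrable_log_two_mul_sin 0 (0 + Real.pi))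
  rw [intervalIntegrable_iff_integrableOn_Ioc_of_le (by linarith [Real.pi_pos])] at h
  have hmp := AddCircle.measurePreserving_mk Real.pi 0
  have h2 : Integrable logKernel (volume : Measure Circ) := by
    rw [← hmp.integrable_comp measurable_logKernel.aestronglyMeasurable]
    refine h.congr (Eventually.of_forall fun x => ?_)
    exact (logKernel_coe x).symm
  rw [volume_eq_smul_haarAddCircle] at h2
  refine (integrable_smul_measure ?_ ENNReal.ofReal_ne_top).1 h2
  simpa using Real.pi_pos

/-- The Fourier coefficients of the logarithmic kernel, from integration by parts on `[0, π]`
against `e_{k+1} - 1`, which cancels the singularities at both ends. -/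
theorem integral_logKernel_mul_fourier (k : ℕ) :
    ∫ h, (logKernel h : ℂ) * fourier (k + 1 : ℤ) h ∂haarAddCircle
      = -(1 / (2 * (k + 1)) : ℂ) := by
  have hpi := Real.pi_pos
  have hpi0 : (Real.pi : ℂ) ≠ 0 := by exact_mod_cast Real.pi_ne_zero
  -- `(e_{k+1} - 1) = S (e₁ - 1)`
  set S : ℝ → ℂ := fun x => ∑ j ∈ Finset.range (k + 1), (fourier (j : ℤ) (x : Circ) : ℂ) with hS
  have hec : ∀ n : ℤ, Continuous fun x : ℝ => (fourier n (x : Circ) : ℂ) := fun n =>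
    (map_continuous (fourier n)).comp (AddCircle.continuous_mk' _)
  have hSc : Continuous S := continuous_finsetSum _ fun j _ => hec j
  have hgeom : ∀ x : ℝ, (fourier (k + 1 : ℤ) (x : Circ) : ℂ) - 1
      = S x * (fourier 1 (x : Circ) - 1) := by
    intro x
    have h := fourier_nat_eq_pow (k + 1) (x : Circ)
    push_cast at h
    simp only [hS]
    rw [h, ← geom_sum_mul]
    simp only [fourier_nat_eq_pow]
  have he1 : ∀ x : ℝ, (fourier 1 (x : Circ) : ℂ) - 1
      = 2 * Complex.I * Complex.exp (x * Complex.I) * Real.sin x := by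
    intro x
    rw [fourier_coe_circ, Complex.ofReal_sin, Complex.sin]
    have h1 : Complex.exp (2 * ((1 : ℤ) : ℂ) * x * Complex.I)
        = Complex.exp (x * Complex.I) * Complex.exp (x * Complex.I) := by
      rw [← Complex.exp_add]; congr 1; push_cast; ring
    have h2 : Complex.exp (x * Complex.I) * Complex.exp (-x * Complex.I) = 1 := by
      rw [← Complex.exp_add]; simp
    rw [h1]
    linear_combination h2
      - (Complex.exp (x * Complex.I) * (Complex.exp (-x * Complex.I) - Complex.exp (x * Complex.I)))
        * Complex.I_sq
  -- the primitive, continuous up to both ends because `s log s` is continuous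
  set F : ℝ → ℂ := fun x => ((fourier (k + 1 : ℤ) (x : Circ) : ℂ) - 1)
    * (Real.log (2 * Real.sin x) : ℝ) with hF
  have hFc : Continuous F := by
    have : F = fun x => S x * Complex.I * Complex.exp (x * Complex.I)
        * ((2 * Real.sin x * Real.log (2 * Real.sin x) : ℝ) : ℂ) := by
      funext x
      simp only [hF]
      rw [hgeom, he1]
      push_cast
      ring
    rw [this]
    refine ((hSc.mul continuous_const).mul (by fun_prop)).mul
      (Complex.continuous_ofReal.comp ?_)
    exact Real.continuous_mul_log.comp (by fun_prop : Continuous fun x : ℝ => 2 * Real.sin x)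
  set A : Circ → ℂ := fun h => ∑ j ∈ Finset.range (k + 1),
    ((fourier (j + 1 : ℤ) h : ℂ) + fourier (j : ℤ) h) with hA
  have hAS : ∀ x : ℝ, A x = S x * (fourier 1 (x : Circ) + 1) := by
    intro x
    simp only [hA, hS, Finset.sum_mul]
    refine Finset.sum_congr rfl fun j _ => ?_
    rw [fourier_add]; ring
  have hder : ∀ x ∈ Ioo 0 Real.pi, HasDerivAt F
      (2 * Complex.I * (k + 1) * ((Real.log (2 * Real.sin x) : ℝ) * fourier (k + 1 : ℤ) (x : Circ))
        + Complex.I * A x) x := by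
    intro x hx
    have hsin : 0 < Real.sin x := Real.sin_pos_of_pos_of_lt_pi hx.1 hx.2
    have hsin0 : (Real.sin x : ℂ) ≠ 0 := by exact_mod_cast hsin.ne'
    have h1 := (hasDerivAt_fourier Real.pi (k + 1) x).sub_const 1
    have h2 : HasDerivAt (fun x => Real.log (2 * Real.sin x))
        (2 * Real.cos x / (2 * Real.sin x)) x :=
      ((Real.hasDerivAt_sin x).const_mul 2).log (by positivity)
    have h3 := h1.mul h2.ofReal_comp
    refine h3.congr_deriv ?_
    rw [hAS, hgeom, he1]
    have h4 : (fourier 1 (x : Circ) : ℂ) + 1 = 2 * Complex.exp (x * Complex.I) * Real.cos x := by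
      have hq := he1 x
      have hcs : Complex.exp (x * Complex.I) = Real.cos x + Real.sin x * Complex.I := by
        rw [Complex.exp_mul_I, Complex.ofReal_cos, Complex.ofReal_sin]
      have hcc : (Real.cos x : ℂ) ^ 2 + (Real.sin x : ℂ) ^ 2 = 1 := by
        exact_mod_cast Real.cos_sq_add_sin_sq x
      rw [sub_eq_iff_eq_add] at hq
      rw [hq, hcs]
      linear_combination (2 * (Real.sin x : ℂ) ^ 2) * Complex.I_sq - 2 * hcc
    rw [h4]
    simp only [Complex.ofReal_div, Complex.ofReal_mul, Complex.ofReal_ofNat, Int.cast_add,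
      Int.cast_natCast, Int.cast_one]
    field_simp
  have hint : IntervalIntegrable (fun x : ℝ => (Real.log (2 * Real.sin x) : ℂ)
      * fourier (k + 1 : ℤ) (x : Circ)) volume 0 Real.pi := by
    have := (intervalIntegrable_log_two_mul_sin 0 Real.pi)
    have h2 : IntervalIntegrable (fun x : ℝ => ((Real.log (2 * Real.sin x) : ℝ) : ℂ))
      volume 0 Real.pi := ⟨this.1.ofReal, this.2.ofReal⟩
    exact h2.mul_continuousOn (hec _).continuousOn
  have hAc : Continuous fun x : ℝ => A x := by
    simp only [hA]
    exact continuous_finsetSum _ fun j _ => (hec _).add (hec _)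
  have hAi : IntervalIntegrable (fun x : ℝ => Complex.I * A x) volume 0 Real.pi :=
    (continuous_const.mul hAc).intervalIntegrable _ _
  have hftc := intervalIntegral.integral_eq_sub_of_hasDerivAt_of_le hpi.le hFc.continuousOn hder
    ((hint.const_mul _).add hAi)
  have hF0 : F 0 = 0 := by simp [hF]
  have hFpi : F Real.pi = 0 := by simp [hF]
  rw [hF0, hFpi, sub_zero, intervalIntegral.integral_add (hint.const_mul _) hAi,
    intervalIntegral.integral_const_mul,
    intervalIntegral.integral_const_mul] at hftc
  have hconv : ∀ f : Circ → ℂ, ∫ x in (0 : ℝ)..Real.pi, f x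
      = Real.pi * ∫ h, f h ∂haarAddCircle := by
    intro f
    have := AddCircle.intervalIntegral_preimage Real.pi 0 f
    rw [zero_add] at this
    rw [this, integral_haarAddCircle, Complex.real_smul]
    push_cast
    field_simp
  have hAint : ∫ h, A h ∂haarAddCircle = 1 := by
    have hz : ∀ n : ℤ, ∫ h, (fourier n h : ℂ) ∂(haarAddCircle : Measure Circ)
        = (Pi.single n (1 : ℂ) : ℤ → ℂ) 0 := by
      intro n
      rw [← fourierCoeff_fourier (T := Real.pi), fourierCoeff]
      simp
    simp only [hA]
    have hi : ∀ j : ℕ, Integrable (fun h : Circ => (fourier (j + 1 : ℤ) h : ℂ) + fourier (j : ℤ) h)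
      haarAddCircle := fun j => (integrable_fourier _).add (integrable_fourier _)
    rw [integral_finsetSum _ fun j _ => hi j]
    rw [Finset.sum_eq_single_of_mem 0 (by simp)]
    · rw [integral_add (integrable_fourier _) (integrable_fourier _), hz, hz]
      simp
    · intro j _ hj
      rw [integral_add (integrable_fourier _) (integrable_fourier _), hz, hz,
        Pi.single_eq_of_ne (by omega), Pi.single_eq_of_ne (by omega), add_zero]
  have hl : ∫ x in (0 : ℝ)..Real.pi, (Real.log (2 * Real.sin x) : ℂ) * fourier (k + 1 : ℤ) (x : Circ)
      = Real.pi * ∫ h, (logKernel h : ℂ) * fourier (k + 1 : ℤ) h ∂haarAddCircle := by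
    rw [← hconv]
    simp only [logKernel_coe]
  rw [hl, hconv, hAint] at hftc
  have hk : ((k : ℂ) + 1) ≠ 0 := by exact_mod_cast Nat.succ_ne_zero k
  field_simp
  have h5 : Complex.I * Real.pi * (2 * (k + 1) *
      (∫ h, (logKernel h : ℂ) * fourier (k + 1 : ℤ) h ∂haarAddCircle) + 1) = 0 := by
    rw [← hftc]; ring
  have h6 := (mul_eq_zero.1 h5).resolve_left (mul_ne_zero Complex.I_ne_zero hpi0)
  linear_combination h6

/-! ### The principal value convolution -/

/-- The convolution of the logarithmic kernel with the derivative of a test function. -/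
def logPotential (φ : TestI) (η : Circ) : ℝ :=
  ∫ h, logKernel h * testCircDeriv φ (η + h) ∂haarAddCircle

theorem stronglyMeasurable_logPotential (φ : TestI) : StronglyMeasurable (logPotential φ) := by
  have h : Measurable (Function.uncurry fun η h : Circ => logKernel h * testCircDeriv φ (η + h)) :=
    (measurable_logKernel.comp measurable_snd).mul
      ((measurable_testCircDeriv φ).comp (measurable_fst.add measurable_snd))
  exact h.stronglyMeasurable.integral_prod_right

theorem memLp_logPotential (φ : TestI) : MemLp (logPotential φ) 2 haarAddCircle := by
  obtain ⟨C, hC⟩ := exists_bound_testCircDeriv φ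
  refine MemLp.of_bound (stronglyMeasurable_logPotential φ).aestronglyMeasurable
    (∫ h, ‖logKernel h‖ * C ∂haarAddCircle) (Eventually.of_forall fun η => ?_)
  refine norm_integral_le_of_norm_le (integrable_logKernel.norm.mul_const C)
    (Eventually.of_forall fun h => ?_)
  rw [norm_mul]
  exact mul_le_mul_of_nonneg_left (hC _) (norm_nonneg _)

/-- The convolution theorem for `logPotential`. -/
theorem fourierCoeff_logPotential (φ : TestI) (n : ℤ) :
    fourierCoeff (cx (logPotential φ)) n
      = (∫ h, (logKernel h : ℂ) * fourier n h ∂haarAddCircle)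
        * fourierCoeff (cx (testCircDeriv φ)) n := by
  obtain ⟨C, hC⟩ := exists_bound_testCircDeriv φ
  have hF : Integrable (Function.uncurry fun η h : Circ => (fourier (-n) η : ℂ)
      * ((logKernel h : ℂ) * (testCircDeriv φ (η + h) : ℂ)))
      ((haarAddCircle : Measure Circ).prod haarAddCircle) := by
    have h1 : Integrable (fun p : Circ × Circ => (logKernel p.2 : ℂ))
        ((haarAddCircle : Measure Circ).prod haarAddCircle) :=
      (integrable_logKernel.ofReal (𝕜 := ℂ)).comp_snd haarAddCircle
    have hm : Measurable (Function.uncurry fun η h : Circ => (fourier (-n) η : ℂ)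
      * ((logKernel h : ℂ) * (testCircDeriv φ (η + h) : ℂ))) := by
      refine Measurable.mul ?_ (Measurable.mul ?_ ?_)
      · exact (map_continuous (fourier (-n))).measurable.comp measurable_fst
      · exact Complex.measurable_ofReal.comp (measurable_logKernel.comp measurable_snd)
      · exact Complex.measurable_ofReal.comp
          ((measurable_testCircDeriv φ).comp (measurable_fst.add measurable_snd))
    refine (h1.norm.mul_const C).mono' hm.aestronglyMeasurable (Eventually.of_forall fun p => ?_)
    simp only [Function.uncurry, norm_mul]
    have hf : ‖(fourier (-n) p.1 : ℂ)‖ = 1 := by rw [fourier_apply, Circle.norm_coe]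
    rw [hf, one_mul, Complex.norm_real (testCircDeriv φ _)]
    exact mul_le_mul_of_nonneg_left (hC _) (norm_nonneg _)
  have h1 : fourierCoeff (cx (logPotential φ)) n = ∫ η, ∫ h, (fourier (-n) η : ℂ)
      * ((logKernel h : ℂ) * (testCircDeriv φ (η + h) : ℂ)) ∂haarAddCircle ∂haarAddCircle := by
    unfold fourierCoeff
    refine integral_congr_ae (Eventually.of_forall fun η => ?_)
    simp only [smul_eq_mul, cx, logPotential]
    rw [integral_const_mul, ← integral_complex_ofReal]
    push_cast
    rfl
  rw [h1, integral_integral_swap hF, ← integral_mul_const]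
  refine integral_congr_ae (Eventually.of_forall fun h => ?_)
  have h2 := fourierCoeff_translate (cx (testCircDeriv φ)) h n
  simp only
  rw [mul_assoc, ← h2, fourierCoeff, ← integral_const_mul]
  refine integral_congr_ae (Eventually.of_forall fun η => ?_)
  simp only [smul_eq_mul, cx]
  ring

/-- Since `-(2 (k + 1))⁻¹ · 2 i (k + 1) = -i`, the logarithmic potential of the derivative is the
conjugate function. -/
theorem hasCoef_logPotential (φ : TestI) :
    HasCoef (logPotential φ) (-(Complex.I • testCoef φ)) := by
  refine ⟨memLp_logPotential φ, fun k => ?_⟩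
  have hk : ((k : ℂ) + 1) ≠ 0 := by exact_mod_cast Nat.succ_ne_zero k
  rw [fourierCoeff_logPotential, integral_logKernel_mul_fourier, fourierCoeff_testCircDeriv,
    lp.coeFn_neg, Pi.neg_apply, lp.coeFn_smul, Pi.smul_apply, (hasCoef_testCoef φ).2 k,
    smul_eq_mul]
  push_cast
  field_simp

/-- `sin (arctan x - arctan y) = (x - y) / √((1 + x²) (1 + y²))`, in logarithms. -/
theorem logKernel_chart_sub {x y : ℝ} (hxy : x ≠ y) :
    logKernel (chart x - chart y) = Real.log 2 + Real.log |x - y|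
      - Real.log (1 + x ^ 2) / 2 - Real.log (1 + y ^ 2) / 2 := by
  have h := norm_fourier_one_sub_one_sq y x
  have h1 := congrArg Real.log h
  have hx : (1 + x ^ 2 : ℝ) ≠ 0 := by positivity
  have hy : (1 + y ^ 2 : ℝ) ≠ 0 := by positivity
  have hd : (x - y) ^ 2 ≠ 0 := pow_ne_zero 2 (sub_ne_zero.2 hxy)
  rw [Real.log_pow, Real.log_div (by positivity) (by positivity), Real.log_mul (by norm_num) hd,
    Real.log_mul hy hx, Real.log_pow, show (4 : ℝ) = 2 ^ 2 by norm_num, Real.log_pow] at h1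
  rw [logKernel, Real.log_abs]
  push_cast at h1
  linarith

theorem integrable_mul_deriv_test (φ : TestI) {g : ℝ → ℝ} (hg : LocallyIntegrable g volume) :
    Integrable (fun x => g x * deriv φ x) := by
  have h := hg.integrable_smul_right_of_hasCompactSupport (TestI.continuous_deriv φ)
    φ.hasCompactSupport.deriv
  simpa using h

theorem integral_deriv_test (φ : TestI) : ∫ x, deriv φ x = 0 :=
  integral_eq_zero_of_hasDerivAt_of_integrable (fun x => TestI.hasDerivAt φ x)
    ((TestI.continuous_deriv φ).integrable_of_hasCompactSupport φ.hasCompactSupport.deriv)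
    (φ.continuous.integrable_of_hasCompactSupport φ.hasCompactSupport)

theorem locallyIntegrable_log_abs_sub (y : ℝ) :
    LocallyIntegrable (fun x : ℝ => Real.log |x - y|) volume := by
  refine (locallyIntegrable_iff).2 fun k hk => ?_
  obtain ⟨a, ha⟩ := hk.bddBelow
  obtain ⟨b, hb⟩ := hk.bddAbove
  have h := ((intervalIntegral.intervalIntegrable_log' (a := a - y) (b := b - y)).comp_sub_right y).1
  simp only [sub_add_cancel] at h
  simp only [Real.log_abs]
  have h' : IntegrableOn (fun x => Real.log (x - y)) (Icc a b) volume := by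
    rwa [integrableOn_Icc_iff_integrableOn_Ioc]
  exact h'.mono_set fun x hx => ⟨ha hx, hb hx⟩

/-- On the line the kernel `log |x - y|` differs from the logarithmic kernel of the circle by terms
in `x` alone, which contribute a constant, and in `y` alone, which are annihilated because a
derivative has integral zero. -/
theorem exists_pvInv_eq_logPotential (φ : TestI) :
    ∃ a : ℝ, ∀ y : ℝ, pvInv (fun x => φ (x + y)) = -Real.pi * logPotential φ (chart y) + a := by
  have hpi := Real.pi_pos
  refine ⟨-∫ x, Real.log (1 + x ^ 2) / 2 * deriv φ x, fun y => ?_⟩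
  have h1 : pvInv (fun x => φ (x + y)) = -∫ x, Real.log |x - y| * deriv φ x := by
    rw [pvInv, ← integral_sub_right_eq_self _ y]
    simp only [deriv_comp_add_const, sub_add_cancel]
  have h2 : logPotential φ (chart y)
      = Real.pi⁻¹ * ∫ x, logKernel (chart x - chart y) * deriv φ x := by
    have hm : AEStronglyMeasurable
        (fun θ => logKernel (θ - chart y) * testCircDeriv φ θ) haarAddCircle :=
      ((measurable_logKernel.comp (measurable_id.sub_const _)).mul
        (measurable_testCircDeriv φ)).aestronglyMeasurable
    have h3 : logPotential φ (chart y)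
        = ∫ θ, logKernel (θ - chart y) * testCircDeriv φ θ ∂haarAddCircle := by
      have h4 := integral_add_left_eq_self (μ := haarAddCircle)
        (fun θ : Circ => logKernel (θ - chart y) * testCircDeriv φ θ) (chart y)
      simp only [add_sub_cancel_left] at h4
      exact h4
    rw [h3, integral_circ_eq hm, ← integral_const_mul]
    refine integral_congr_ae (Eventually.of_forall fun x => ?_)
    simp only [testCircDeriv_chart, cauchyDensity, smul_eq_mul]
    field_simp
  have hi1 := integrable_mul_deriv_test φ (locallyIntegrable_log_abs_sub y)
  have hi2 : Integrable fun x => Real.log (1 + x ^ 2) / 2 * deriv φ x := by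
    refine integrable_mul_deriv_test φ (Continuous.locallyIntegrable ?_)
    refine Continuous.div_const (Continuous.log (by fun_prop) fun x => ?_) 2
    positivity
  have hi3 : Integrable fun x => (Real.log 2 - Real.log (1 + y ^ 2) / 2) * deriv φ x :=
    ((TestI.continuous_deriv φ).integrable_of_hasCompactSupport
      φ.hasCompactSupport.deriv).const_mul _
  have h4 : ∫ x, logKernel (chart x - chart y) * deriv φ x
      = (∫ x, Real.log |x - y| * deriv φ x) - ∫ x, Real.log (1 + x ^ 2) / 2 * deriv φ x := by
    have h5 : ∫ x, (Real.log 2 - Real.log (1 + y ^ 2) / 2) * deriv φ x = 0 := by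
      rw [integral_const_mul, integral_deriv_test, mul_zero]
    have hi12 : Integrable fun x => Real.log |x - y| * deriv φ x
        - Real.log (1 + x ^ 2) / 2 * deriv φ x := hi1.sub hi2
    rw [← add_zero ((∫ x, Real.log |x - y| * deriv φ x) - _), ← h5, ← integral_sub hi1 hi2,
      ← integral_add hi12 hi3]
    refine integral_congr_ae ?_
    filter_upwards [(countable_singleton y).ae_notMem volume] with x hx
    rw [logKernel_chart_sub hx]
    ring
  rw [h1, h2, h4]
  field_simp
  ring

/-- Up to a constant, the function `y ↦ ⟨pv 1/x, φ(x + y)⟩` on the interval has the coefficients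
`i π` times those of `φ`. -/
theorem restrictCoef_pvInv_sub_mem (φ : TestI)
    (h : ContDiff ℝ 1 fun y => pvInv (fun x => φ (x + y))) :
    restrictCoef (Real.pi • (Complex.I • testCoef φ)) - restr _ h
      ∈ Submodule.span ℝ {one} := by
  have h1 := (hasCoef_logPotential φ).smul (-Real.pi)
  rw [smul_neg, neg_smul Real.pi (Complex.I • testCoef φ), neg_neg] at h1
  obtain ⟨a, ha⟩ := h1.restrictCoef_ae
  obtain ⟨b, hb⟩ := exists_pvInv_eq_logPotential φ
  refine sub_mem_span_one_iff.2 ⟨a - b, ?_⟩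
  filter_upwards [ha, H12.coeFn_mk _ (memH12_of_contDiff h)] with x hx hx'
  rw [hx, restr, hx', hb]
  simp only [Pi.smul_apply, smul_eq_mul]
  ring

/-! ### The equation and the sign property -/

/-- A smooth function with compact support in `]-1,1[` and integral zero is the derivative of a test
function. -/
theorem exists_test_deriv_eq {h : ℝ → ℝ} (hsm : ContDiff ℝ (⊤ : ℕ∞) h) (hc : HasCompactSupport h)
    (hs : tsupport h ⊆ Ioo (-1 : ℝ) 1) (h0 : ∫ x, h x = 0) : ∃ φ : TestI, deriv φ = h := by
  obtain ⟨r, hr0, hr1, hr⟩ : ∃ r : ℝ, 0 ≤ r ∧ r < 1 ∧ tsupport h ⊆ Icc (-r) r := by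
    rcases (tsupport h).eq_empty_or_nonempty with he | hne
    · exact ⟨0, le_rfl, one_pos, by rw [he]; exact empty_subset _⟩
    · obtain ⟨x, hx, hmax⟩ := hc.isCompact.exists_isMaxOn hne continuous_abs.continuousOn
      exact ⟨|x|, abs_nonneg x, abs_lt.2 (hs hx), fun y hy => abs_le.1 (hmax hy)⟩
  have hz : ∀ x, x ∉ Icc (-r) r → h x = 0 := fun x hx =>
    image_eq_zero_of_notMem_tsupport fun hx' => hx (hr hx')
  set ψ : ℝ → ℝ := fun x => ∫ y in (-1 : ℝ)..x, h y with hψ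
  have hd : ∀ x, HasDerivAt ψ (h x) x := fun x =>
    intervalIntegral.integral_hasDerivAt_right (hsm.continuous.intervalIntegrable _ _)
      hsm.continuous.stronglyMeasurable.stronglyMeasurableAtFilter hsm.continuous.continuousAt
  have hde : deriv ψ = h := funext fun x => (hd x).deriv
  have hψsm : ContDiff ℝ (⊤ : ℕ∞) ψ := by
    rw [contDiff_infty_iff_deriv]
    exact ⟨fun x => (hd x).differentiableAt, by rw [hde]; exact hsm⟩
  have hsupp : Function.support ψ ⊆ Icc (-r) r := by
    intro x hx
    by_contra hxr
    refine hx ?_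
    simp only [hψ]
    rw [mem_Icc, not_and_or, not_le, not_le] at hxr
    rcases hxr with hxr | hxr
    · refine intervalIntegral.integral_zero_ae (Eventually.of_forall fun y hy => hz y ?_)
      intro hy'
      rcases le_total (-1) x with h1 | h1
      · rw [uIoc_of_le h1] at hy
        linarith [hy.2, hy'.1]
      · rw [uIoc_of_ge h1] at hy
        linarith [hy.2, hy'.1]
    · have hxr' : -1 ≤ x := by linarith
      rw [intervalIntegral.integral_of_le hxr', ← h0, setIntegral_eq_integral_of_forall_compl_eq_zero]
      intro y hy
      refine hz y fun hy' => hy ⟨by linarith [hy'.1], by linarith [hy'.2]⟩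
  have hts : tsupport ψ ⊆ Icc (-r) r := closure_minimal hsupp isClosed_Icc
  refine ⟨⟨ψ, hψsm, HasCompactSupport.of_support_subset_isCompact isCompact_Icc hsupp,
    hts.trans fun x hx => ⟨by linarith [hx.1], by linarith [hx.2]⟩⟩, hde⟩

/-- The lemma of du Bois-Reymond: a function on `]-1,1[` whose distributional derivative vanishes
is constant. -/
theorem ae_const_of_integral_mul_deriv_eq_zero {w : ℝ → ℝ} (hw : Integrable w μI)
    (h : ∀ φ : TestI, ∫ x in Ioo (-1 : ℝ) 1, w x * deriv φ x = 0) :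
    ∃ a : ℝ, ∀ᵐ x ∂μI, w x = a := by
  -- subtracting a multiple of a fixed bump `ρ` of integral one makes any `g` a derivative
  let b : ContDiffBump (0 : ℝ) := ⟨1 / 4, 1 / 2, by norm_num, by norm_num⟩
  set ρ : ℝ → ℝ := b.normed volume with hρ
  have hρsm : ContDiff ℝ (⊤ : ℕ∞) ρ := b.contDiff_normed
  have hρc : HasCompactSupport ρ := b.hasCompactSupport_normed
  have hρs : tsupport ρ ⊆ Ioo (-1 : ℝ) 1 := by
    rw [hρ, b.tsupport_normed_eq, Real.closedBall_eq_Icc]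
    intro x hx
    have h1 : b.rOut = 1 / 2 := rfl
    rw [h1] at hx
    exact ⟨by linarith [hx.1], by linarith [hx.2]⟩
  have hρ1 : ∫ x, ρ x = 1 := b.integral_normed
  set a : ℝ := ∫ x in Ioo (-1 : ℝ) 1, w x * ρ x with ha
  have hwm : ∀ {g : ℝ → ℝ}, Continuous g → HasCompactSupport g →
      Integrable (fun x => w x * g x) μI := by
    intro g hg hgc
    obtain ⟨C, hC⟩ := hgc.exists_bound_of_continuous hg
    exact hw.mul_bdd hg.aestronglyMeasurable (Eventually.of_forall hC)
  have key : ∀ᵐ x, x ∈ Ioo (-1 : ℝ) 1 → w x - a = 0 := by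
    refine isOpen_Ioo.ae_eq_zero_of_integral_contDiff_smul_eq_zero ?_ ?_
    · exact (IntegrableOn.locallyIntegrableOn (f := fun x => w x - a) (s := Ioo (-1 : ℝ) 1)
        (hw.sub (integrable_const a)))
    · intro g hg hgc hgs
      set m : ℝ := ∫ x, g x
      obtain ⟨φ, hφ⟩ := exists_test_deriv_eq (h := fun x => g x - m * ρ x)
        (hg.sub (contDiff_const.mul hρsm)) (hgc.sub hρc.mul_left)
        ((tsupport_sub g _).trans (union_subset hgs
          ((closure_mono (Function.support_mul_subset_right _ _)).trans hρs))) (by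
          rw [integral_sub (hg.continuous.integrable_of_hasCompactSupport hgc)
            ((hρsm.continuous.integrable_of_hasCompactSupport hρc).const_mul _),
            integral_const_mul, hρ1, mul_one, sub_self])
      have h1 := h φ
      rw [hφ] at h1
      have h2 : ∫ x in Ioo (-1 : ℝ) 1, w x * (g x - m * ρ x)
          = (∫ x in Ioo (-1 : ℝ) 1, w x * g x) - m * a := by
        rw [ha, ← integral_const_mul, ← integral_sub (hwm hg.continuous hgc)
          ((hwm hρsm.continuous hρc).const_mul m)]
        refine integral_congr_ae (Eventually.of_forall fun x => ?_)
        simp only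
        ring
      have h3 : ∫ x in Ioo (-1 : ℝ) 1, g x = m := by
        refine setIntegral_eq_integral_of_forall_compl_eq_zero fun x hx => ?_
        exact image_eq_zero_of_notMem_tsupport fun hx' => hx (hgs hx')
      have h4 : ∫ x, g x • (w x - a) = ∫ x in Ioo (-1 : ℝ) 1, g x • (w x - a) := by
        refine (setIntegral_eq_integral_of_forall_compl_eq_zero fun x hx => ?_).symm
        rw [image_eq_zero_of_notMem_tsupport fun hx' => hx (hgs hx'), zero_smul]
      have h5 : ∫ x in Ioo (-1 : ℝ) 1, g x • (w x - a)
          = (∫ x in Ioo (-1 : ℝ) 1, w x * g x) - a * ∫ x in Ioo (-1 : ℝ) 1, g x := by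
        rw [← integral_const_mul, ← integral_sub (hwm hg.continuous hgc)
          ((hg.continuous.integrable_of_hasCompactSupport hgc).restrict.const_mul a)]
        refine integral_congr_ae (Eventually.of_forall fun x => ?_)
        simp only [smul_eq_mul]
        ring
      rw [h4, h5, h3]
      linarith
  refine ⟨a, ?_⟩
  rw [ae_restrict_iff' measurableSet_Ioo]
  filter_upwards [key] with x hx hxI
  linarith [hx hxI]

theorem norm_I_smul (c : Coef) : ‖Complex.I • c‖ = ‖c‖ := by
  rw [norm_smul, Complex.norm_I, one_mul]

theorem inner_I_smul_I_smul (c d : Coef) : ⟪Complex.I • c, Complex.I • d⟫_ℝ = ⟪c, d⟫_ℝ := by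
  rw [lp.inner_eq_tsum, lp.inner_eq_tsum]
  refine tsum_congr fun k => ?_
  simp only [lp.coeFn_smul, Pi.smul_apply, smul_eq_mul, Complex.inner, map_mul, Complex.conj_I]
  congr 1
  linear_combination (-(d k * conj (c k))) * Complex.I_sq

theorem inner_I_smul_self (c : Coef) : ⟪Complex.I • c, c⟫_ℝ = 0 := by
  rw [lp.inner_eq_tsum]
  have : ∀ k, ⟪(Complex.I • c : Coef) k, c k⟫_ℝ = 0 := by
    intro k
    simp only [lp.coeFn_smul, Pi.smul_apply, smul_eq_mul, Complex.inner, map_mul, Complex.conj_I]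
    simp [Complex.mul_re, Complex.mul_im]
    ring
  rw [tsum_congr this, tsum_zero]

/-- Multiplication by `π⁻¹ (1 - i f)`. The isomorphism `A` is `R ∘ frictionMul f ∘ R*` modulo
constants, with `R = restrictCoef`. -/
def frictionMul (f : ℝ) : Coef →L[ℝ] Coef :=
  LinearMap.mkContinuous
    { toFun := fun c => Real.pi⁻¹ • (c - f • (Complex.I • c))
      map_add' := fun c d => by simp only [smul_add, smul_sub]; abel
      map_smul' := fun a c => by
        rw [RingHom.id_apply, smul_comm Complex.I a c, smul_comm f a, ← smul_sub,
          smul_comm a Real.pi⁻¹] }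
    (Real.pi⁻¹ * (1 + |f|)) (fun c => by
      have hpi := Real.pi_pos
      change ‖Real.pi⁻¹ • (c - f • (Complex.I • c))‖ ≤ _
      rw [norm_smul, Real.norm_of_nonneg (by positivity), mul_assoc]
      gcongr
      refine (norm_sub_le _ _).trans ?_
      rw [norm_smul, norm_I_smul, Real.norm_eq_abs]
      linarith)

theorem frictionMul_apply (f : ℝ) (c : Coef) :
    frictionMul f c = Real.pi⁻¹ • (c - f • (Complex.I • c)) := rfl

theorem inner_frictionMul_self (f : ℝ) (c : Coef) :
    ⟪frictionMul f c, c⟫_ℝ = Real.pi⁻¹ * (‖c‖ * ‖c‖) := by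
  rw [frictionMul_apply, real_inner_smul_left, inner_sub_left, real_inner_smul_left,
    inner_I_smul_self, mul_zero, sub_zero, real_inner_self_eq_norm_mul_norm]

/-- `τ = π (1 + i f) c / (1 + f²)` when `c = π⁻¹ (1 - i f) τ`. -/
theorem eq_frictionMul_inv (f : ℝ) (c : Coef) :
    (1 + f ^ 2) • c = Real.pi • (frictionMul f c + f • (Complex.I • frictionMul f c)) := by
  have hpi := Real.pi_ne_zero
  have hII : Complex.I • (Complex.I • c) = -c := by
    rw [smul_smul, Complex.I_mul_I, neg_one_smul]
  rw [frictionMul_apply, smul_comm Complex.I Real.pi⁻¹, smul_comm f Real.pi⁻¹, ← smul_add,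
    smul_smul, mul_inv_cancel₀ hpi, one_smul, smul_sub Complex.I, smul_comm Complex.I f, hII,
    smul_sub f, smul_neg, smul_neg, smul_smul, add_smul, one_smul, sq]
  abel

/-- Both sides of the equation, tested with `φ`, in terms of coefficients. -/
theorem contactEq_lhs (f : ℝ) (t : H0star) (φ : TestI) :
    -(1 / Real.pi) * pvConv t φ
      + f * (t : Hm12) (restr φ (φ.contDiff.of_le (by simp)))
      = distDeriv (restrictCoef (frictionMul f (rieszPull restrictCoef t))) φ := by
  have hpi := Real.pi_ne_zero
  set τ := rieszPull restrictCoef (t : Hm12)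
  set d := testCoef φ
  have h1 : pvConv t φ = Real.pi * ⟪τ, Complex.I • d⟫_ℝ := by
    rw [pvConv, ← H0star_apply_eq t.2 (restrictCoef_pvInv_sub_mem φ _), ← inner_rieszPull,
      real_inner_smul_right]
  have h2 : (t : Hm12) (restr φ (φ.contDiff.of_le (by simp))) = ⟪τ, d⟫_ℝ := by
    rw [← H0star_apply_eq t.2 (restrictCoef_testCoef_sub_mem φ _), ← inner_rieszPull]
  have h3 : distDeriv (restrictCoef (frictionMul f τ)) φ
      = -(Real.pi * ⟪frictionMul f τ, Complex.I • d⟫_ℝ) := by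
    rw [distDeriv, ← (hasCoef_synth _).integral_mul_deriv]
    congr 1
    refine integral_congr_ae ?_
    filter_upwards [restrictCoef_ae (frictionMul f τ)] with x hx
    rw [hx]
  rw [h1, h2, h3, frictionMul_apply, real_inner_smul_left, inner_sub_left, real_inner_smul_left,
    inner_I_smul_I_smul]
  field_simp
  ring

/-- Two elements of `H^{1/2}` have the same derivative exactly when they differ by a constant. -/
theorem distDeriv_eq_iff (u v : H12) :
    (∀ φ : TestI, distDeriv v φ = distDeriv u φ) ↔ v - u ∈ Submodule.span ℝ {one} := by
  have hint : ∀ (w : H12) (φ : TestI), Integrable (fun x => w x * deriv φ x) μI := by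
    intro w φ
    obtain ⟨C, hC⟩ := φ.hasCompactSupport.deriv.exists_bound_of_continuous
      (TestI.continuous_deriv φ)
    exact (w.memH12.1.integrable one_le_two).mul_bdd
      (TestI.continuous_deriv φ).aestronglyMeasurable (Eventually.of_forall hC)
  have hdiff : ∀ φ : TestI, ∫ x in Ioo (-1 : ℝ) 1, (v x - u x) * deriv φ x
      = distDeriv u φ - distDeriv v φ := by
    intro φ
    rw [distDeriv, distDeriv, neg_sub_neg, ← integral_sub (hint v φ) (hint u φ)]
    simp only [sub_mul]
  rw [sub_mem_span_one_iff]
  constructor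
  · intro h
    obtain ⟨a, ha⟩ := ae_const_of_integral_mul_deriv_eq_zero (w := fun x => v x - u x)
      ((v.memH12.1.integrable one_le_two).sub (u.memH12.1.integrable one_le_two))
      fun φ => by rw [hdiff, h φ, sub_self]
    refine ⟨a, ?_⟩
    filter_upwards [ha] with x hx
    linarith
  · rintro ⟨a, ha⟩ φ
    have h1 := hdiff φ
    have h2 : ∫ x in Ioo (-1 : ℝ) 1, (v x - u x) * deriv φ x
        = a * ∫ x in Ioo (-1 : ℝ) 1, deriv φ x := by
      rw [← integral_const_mul]
      refine integral_congr_ae ?_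
      filter_upwards [ha] with x hx
      rw [hx, add_sub_cancel_left]
    have h3 : ∫ x in Ioo (-1 : ℝ) 1, deriv φ x = 0 := by
      rw [← integral_deriv_test φ]
      refine setIntegral_eq_integral_of_forall_compl_eq_zero fun x hx => ?_
      by_contra hne
      exact hx (φ.tsupport_subset (support_deriv_subset hne))
    rw [h2, h3, mul_zero] at h1
    linarith

/-- The sign property. With `c` the coefficients of `V`, where `V - a` extends `u` to the circle,
and `d` those of `(V - a)⁺`, the duality product is `π / (1 + f²)` times `⟪c, d⟫ ≥ ‖d‖²`, because
the contribution of the friction term is `⟪i c, d⟫ = 0`. -/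
theorem exists_coef_posPart (f : ℝ) (t : H0star) (u : ℝ → ℝ) (hu : MemH12 u)
    (ht : restrictCoef (frictionMul f (rieszPull restrictCoef (t : Hm12))) - H12.mk u hu
      ∈ Submodule.span ℝ {one}) :
    ∃ (hup : MemH12 (fun x => max (u x) 0)) (W : Circ → ℝ) (d : Coef), HasCoef W d ∧
      (∀ᵐ x ∂μI, max (u x) 0 = W (chart x)) ∧
      Real.pi / (1 + f ^ 2) * ‖d‖ ^ 2 ≤ (t : Hm12) (H12.mk (fun x => max (u x) 0) hup) := by
  have hpi := Real.pi_pos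
  set τ := rieszPull restrictCoef (t : Hm12)
  set c := frictionMul f τ
  obtain ⟨a, ha⟩ := sub_mem_span_one_iff.1 ht
  set G : ℝ → ℝ := fun s => max (s - a) 0
  have hGm : Monotone G := fun s r h => max_le_max (sub_le_sub_right h a) le_rfl
  have hGL : LipschitzWith 1 G := by
    have : LipschitzWith 1 fun s : ℝ => s - a := LipschitzWith.of_dist_le_mul fun s r => by simp
    exact this.max_const 0
  obtain ⟨d, hd, hdc⟩ := (hasCoef_synth c).exists_comp hGm hGL
  have hWm : Measurable (G ∘ synth c) := hGL.continuous.measurable.comp (measurable_synth c)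
  have hae : (fun x => (G ∘ synth c) (chart x)) =ᵐ[μI] fun x => max (u x) 0 := by
    filter_upwards [ha, restrictCoef_ae c, H12.coeFn_mk u hu] with x h1 h2 h3
    simp only [Function.comp_apply, G]
    rw [← h2, h1, h3, add_sub_cancel_right]
  have hup : MemH12 fun x => max (u x) 0 := (memH12_chart hWm hd).congr hae
  refine ⟨hup, G ∘ synth c, d, hd, hae.symm, ?_⟩
  have hmem : restrictCoef d - H12.mk _ hup ∈ Submodule.span ℝ {one} := by
    obtain ⟨b, hb⟩ := hd.restrictCoef_ae
    refine sub_mem_span_one_iff.2 ⟨b, ?_⟩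
    filter_upwards [hb, hae, H12.coeFn_mk _ hup] with x h1 h2 h3
    rw [h1, h3, ← h2]
  rw [← H0star_apply_eq t.2 hmem, ← inner_rieszPull]
  have hskew := inner_I_smul_comp hGm hGL (hasCoef_synth c) (fourierCoeff_synth_zero c) hd
  have h1 : (1 + f ^ 2) * ⟪τ, d⟫_ℝ = Real.pi * ⟪c, d⟫_ℝ := by
    rw [← real_inner_smul_left, eq_frictionMul_inv, real_inner_smul_left, inner_add_left,
      real_inner_smul_left, hskew, mul_zero, add_zero]
  rw [div_mul_eq_mul_div, div_le_iff₀ (by positivity), mul_comm ⟪_, _⟫_ℝ, h1]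
  exact mul_le_mul_of_nonneg_left hdc hpi.le

end Contact

end

theorem mainTheorem8 (f : ℝ) :
    ∃ A : Contact.H0star ≃L[ℝ] Contact.H0,
      (∀ (t : Contact.H0star) (u : Contact.H12),
        A t = Contact.toH0 u ↔ Contact.ContactEq f t u) ∧
      ∀ (u : ℝ → ℝ) (hu : Contact.MemH12 u),
        ∃ hup : Contact.MemH12 (fun x => max (u x) 0),
          0 ≤ (A.symm (Contact.toH0 (Contact.H12.mk u hu)) : Contact.Hm12)
              (Contact.H12.mk (fun x => max (u x) 0) hup) ∧
          ((A.symm (Contact.toH0 (Contact.H12.mk u hu)) : Contact.Hm12)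
              (Contact.H12.mk (fun x => max (u x) 0) hup) = 0 ↔
            ∃ c : ℝ, ∀ᵐ x ∂Contact.μI, max (u x) 0 = c) := by
  have hpi := Real.pi_pos
  obtain ⟨A, hA⟩ := Contact.exists_equiv_of_coercive Contact.restrictCoef
    Contact.exists_restrictCoef_lift (Contact.frictionMul f) (inv_pos.2 hpi)
    fun d => (Contact.inner_frictionMul_self f d).ge
  refine ⟨A, fun t u => ?_, fun u hu => ?_⟩
  · rw [hA, Contact.toH0_eq_iff, ← Contact.distDeriv_eq_iff]
    exact forall_congr' fun φ => by rw [Contact.contactEq_lhs]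
  · set t := A.symm (Contact.toH0 (Contact.H12.mk u hu)) with ht
    have hAt := hA t
    rw [ht, ContinuousLinearEquiv.apply_symm_apply, ← ht] at hAt
    obtain ⟨hup, W, d, hWd, hW, hle⟩ := Contact.exists_coef_posPart f t u hu
      (Contact.toH0_eq_iff.1 hAt.symm)
    have hd : 0 ≤ Real.pi / (1 + f ^ 2) * ‖d‖ ^ 2 := by positivity
    refine ⟨hup, hd.trans hle, fun h0 => ?_, fun ⟨c, hc⟩ => ?_⟩
    · rw [h0] at hle
      have h1 : ‖d‖ ^ 2 ≤ 0 := nonpos_of_mul_nonpos_right hle (by positivity)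
      have hd0 : d = 0 := by
        rw [← norm_eq_zero]
        exact pow_eq_zero_iff two_ne_zero |>.1 (le_antisymm h1 (sq_nonneg _))
      rw [hd0] at hWd
      obtain ⟨c, hc⟩ := hWd.ae_const
      refine ⟨c, ?_⟩
      filter_upwards [hW, Contact.ae_chart hc] with x h2 h3
      rw [h2, h3]
    · have hmem : Contact.H12.mk _ hup - 0 ∈ Submodule.span ℝ {Contact.one} := by
        rw [sub_zero]
        refine Contact.mem_span_one_iff.2 ⟨c, ?_⟩
        filter_upwards [hc, Contact.H12.coeFn_mk _ hup] with x h2 h3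
        rw [h3, h2]
      rw [Contact.H0star_apply_eq t.2 hmem, map_zero]
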